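/- **Setting.** For a unit vector $v\in\mathbb S^{d-1}$ and a probability distribution $A$ on $\mathbb R$, let $P_{A,v}$ be the distribution on $\mathbb R^d$ whose component in the direction $v$ has law $A$ and whose component in $v^\perp$ is an independent standard Gaussian. For $\eta\in(0,1/2)$, $\alpha\in(0,1)$ and a family of probability distributions $(Q_v)_{v\in\mathbb S^{d-1}}$ on $\mathbb R^d$ depending measurably on $v$, *robust Gaussian covariance testing* with $n$ samples is the problem of distinguishing, given $y=(y_1,\dots,y_n)\in(\mathbb R^d)^n$, - $H_0$: $y_1,\dots,y_n$ are i.i.d. from $\mathcal N(0,I_d)$; - $H_1$: $v$ is drawn uniformly from $\mathbb S^{d-1}$ and, conditionally on $v$, $y_1,\dots,y_n$ are i.i.d. from $(1-\eta)\,\mathcal N(0,I_d-\alpha vv^\top)+\eta\,Q_v$. Its degree-$D$ advantage is $$\mathrm{Adv}_{\le D,n}=\sup_f \frac{\mathbb E_{H_1}[f(y)]}{\sqrt{\mathbb E_{H_0}[f(y)^2]}},$$ the supremum being over the nonzero real polynomials $f$ of degree at most $D$ in the $nd$ coordinates of $y$. **Proposition.** There is a real polynomial $p$, positive on $\mathbb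 N$, such that for every $c>0$ there is a constant $B$, depending only on $c$, with the following property. Let $d\ge 1$, $\alpha\in(0,1)$ and $\eta\in(0,1/2)$ with $\eta\ge c/\sqrt d$. Then there are $\delta>0$ and a measurable family of probability distributions $(Q_v)_{v\in\mathbb S^{d-1}}$ such that: 1. For every unit vector $v$, $$Q_v=P_{A',v},\qquad A'=\tfrac12\mathcal N(\delta,1)+\tfrac12\mathcal N(-\delta,1),$$ and $$(1-\eta)\,\mathcal N(0,I_d-\alpha vv^\top)+\eta\,Q_v=P_{A,v},\qquad A=(1-\eta)\,\mathcal N(0,1-\alpha)+\tfrac{\eta}{2}\mathcal N(\delta,1)+\tfrac{\eta}{2}\mathcal N(-\delta,1);$$ that is, $H_1$ is a non-Gaussian component analysis (NGCA) instance with a symmetric Gaussian-mixture hidden distribution. 2. For every $n$, the law of $y$ under $H_1$ is a probability distribution under which every polynomial is integrable. 3. For all $n,D\in\mathbb N$ with $$d\;\le\; n\;\le\;\frac{d^2\eta^2}{p(D)\,\alpha^4},$$ one has $\mathrm{Adv}_{\le D,n}\le B$. -/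

import Mathlib

open MeasureTheory ProbabilityTheory Metric
open scoped ENNReal NNReal

noncomputable section

namespace LowDegree

/-- `ℝ^d` with its Euclidean structure. -/
abbrev Space (d : ℕ) : Type := EuclideanSpace ℝ (Fin d)

/-- The unit sphere `S^{d-1}` of `ℝ^d`. -/
abbrev Sphere (d : ℕ) : Type := sphere (0 : Space d) 1

/-- An input `y = (y_1, …, y_n)` of `n` points in `ℝ^d`. -/
abbrev Sample (n d : ℕ) : Type := Fin n → Space d

/-- The uniform probability distribution on `S^{d-1}` (for `d ≥ 1`): the normalized
surface measure. -/
def uniformSphere (d : ℕ) : Measure (Sphere d) :=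
  ((volume : Measure (Space d)).toSphere Set.univ)⁻¹ • (volume : Measure (Space d)).toSphere

/-- The mixture `(1 - w) μ + w ν` of two distributions, for `w ∈ [0, 1]`. -/
def mix {Ω : Type} [MeasurableSpace Ω] (w : ℝ) (μ ν : Measure Ω) : Measure Ω :=
  ENNReal.ofReal (1 - w) • μ + ENNReal.ofReal w • ν

/-- The hidden direction distribution `P_{A,v}`: the product distribution whose component in the
direction of the unit vector `v` has law `A`, and whose component in the orthogonal complement of
`v` is standard Gaussian. It is the law of `t v + (g - ⟨v, g⟩ v)` for independent `t ∼ A` and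
`g ∼ N(0, I_d)`. -/
def hiddenDirection {d : ℕ} (A : Measure ℝ) (v : Sphere d) : Measure (Space d) :=
  (A.prod (stdGaussian (Space d))).map
    fun p => p.1 • (v : Space d) + (p.2 - inner ℝ (v : Space d) p.2 • (v : Space d))

/-- The inlier distribution `N(0, I_d - α v vᵀ)`. -/
def inlier {d : ℕ} (α : ℝ) (v : Sphere d) : Measure (Space d) :=
  multivariateGaussian 0
    (1 - α • Matrix.vecMulVec (fun i => (v : Space d) i) (fun i => (v : Space d) i))

/-- The null distribution: `n` i.i.d. samples from `N(0, I_d)`. -/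
def nullLaw (n d : ℕ) : Measure (Sample n d) :=
  Measure.pi fun _ => stdGaussian (Space d)

/-- The alternative distribution: first `v` is uniform on the sphere, then, conditionally on `v`,
the input consists of `n` i.i.d. samples from `D v`. -/
def altLaw (n : ℕ) {d : ℕ} (D : Sphere d → Measure (Space d)) : Measure (Sample n d) :=
  (uniformSphere d).bind fun v => Measure.pi fun _ => D v

/-- Polynomials in the `n d` real coordinates of the input. -/
abbrev Poly (n d : ℕ) : Type := MvPolynomial (Fin n × Fin d) ℝ

/-- The value of a polynomial at an input. -/
def evalAt {n d : ℕ} (f : Poly n d) (y : Sample n d) : ℝ :=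
  MvPolynomial.eval (fun p => y p.1 p.2) f

/-- The degree-`D` advantage of testing `H₀ : y ∼ Q` against `H₁ : y ∼ P`: the supremum of
`E_P[f] / √(E_Q[f²])` over the polynomials `f` of degree at most `D` for which the denominator does
not vanish. -/
def degreeAdvantage {n d : ℕ} (D : ℕ) (Q P : Measure (Sample n d)) : EReal :=
  ⨆ f : {f : Poly n d // f.totalDegree ≤ D ∧ 0 < ∫ y, evalAt f y ^ 2 ∂Q},
    (((∫ y, evalAt f.1 y ∂P) / Real.sqrt (∫ y, evalAt f.1 y ^ 2 ∂Q) : ℝ) : EReal)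

/-- The symmetric two-component Gaussian mixture `½ N(δ, 1) + ½ N(-δ, 1)`. -/
def symmetricPair (δ : ℝ) : Measure ℝ :=
  mix (1 / 2) (gaussianReal δ 1) (gaussianReal (-δ) 1)

/-- The hidden distribution `(1 - η) N(0, 1 - α) + (η/2) N(δ, 1) + (η/2) N(-δ, 1)`. -/
def hiddenLaw (η α δ : ℝ) : Measure ℝ :=
  mix η (gaussianReal 0 (1 - α).toNNReal) (symmetricPair δ)

end LowDegree

end

/-!
The separation `δ` is chosen with `η δ² = α (1 - η)`, so that the symmetric hidden law `A` has
variance `1` and agrees with `N(0, 1)` up to the third moment. The advantage is then controlled by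
the second moment of the low-degree likelihood ratio, computed in the Hermite basis.

Gaussian integration by parts (`integral_X_mul_gaussianReal`) makes the expectation of a polynomial
under `P_{A,v}` a pairing, under the standard Gaussian, with the Hermite series of `A` in the
variable `⟨v, y⟩`. Hence every polynomial of degree at most `D` has the same mean under `n` samples
from `P_{A,v}` as against `lowDegreeRatio A D v` under the null law
(`integral_evalAt_hiddenDirection`). By Cauchy–Schwarz the squared advantage is at most the null
second moment of the average of these ratios over `v` (`degreeAdvantage_altLaw_le`), and by
orthogonality (`integral_lowDegreeRatio_mul`) this second moment is
`∑_K (∏ᵢ E_A[He_{Kᵢ}]² / Kᵢ!) · E⟨u, v⟩^{|K|}`, over multi-degrees `K` with `|K| ≤ D`.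

For independent uniform unit vectors, `E⟨u, v⟩^{2m} ≤ (D / d)^m` as long as `2m ≤ D`
(`integral_inner_pow_uniformSphere_le`), which follows from polar coordinates for the Gaussian. The
sum over `K` is therefore at most an `n`-th power
`(1 + ∑_{j ≥ 2} (E_A[He_{2j}]² / (2j)!) (D / d)^j)^n` (`sum_degreeProfiles_le`), where the `j`-th term
is at most `4 η² x^j` with `x = α² D / (d η²)` (`hermiteWeight_hiddenLaw_even_le`). The constraints
on `n` bound `n · 4 η² x²` by `1` and `x` by `1 / (c D)`, so the `n`-th power is at most
`exp (exp (1 / c))` (`geometric_exponent_le`).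
-/

noncomputable section

namespace LowDegree

open Polynomial

/-! ### Functions with finite moments of every order -/

section HasMoments
variable {Ω Ω' : Type*} [MeasurableSpace Ω] [MeasurableSpace Ω'] {μ : Measure Ω} {F G : Ω → ℝ}

/-- `F` is almost everywhere strongly measurable and has finite absolute moments of every order.
Quantifying over the orders `n : ℕ` makes the class closed under products. -/
def HasMoments (F : Ω → ℝ) (μ : Measure Ω) : Prop := ∀ n : ℕ, MemLp F n μ

lemma HasMoments.integrable (h : HasMoments F μ) : Integrable F μ :=
  memLp_one_iff_integrable.1 (by simpa using h 1)

lemma HasMoments.mono (h : HasMoments F μ) (hG : AEStronglyMeasurable G μ)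
    (hle : ∀ x, |G x| ≤ |F x|) : HasMoments G μ :=
  fun n => (h n).mono hG (.of_forall hle)

lemma HasMoments.add (hF : HasMoments F μ) (hG : HasMoments G μ) :
    HasMoments (fun x => F x + G x) μ := fun n => (hF n).add (hG n)

lemma HasMoments.mul (hF : HasMoments F μ) (hG : HasMoments G μ) :
    HasMoments (fun x => F x * G x) μ := by
  intro n
  have : ENNReal.HolderTriple ((2 * n : ℕ) : ℝ≥0∞) ((2 * n : ℕ) : ℝ≥0∞) (n : ℝ≥0∞) := by
    constructor
    push_cast
    rw [ENNReal.mul_inv (by simp) (by simp), ← add_mul, ENNReal.inv_two_add_inv_two, one_mul]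
  exact (hG (2 * n)).mul (hF (2 * n))

lemma hasMoments_const [IsFiniteMeasure μ] (c : ℝ) : HasMoments (fun _ => c) μ :=
  fun _ => memLp_const c

lemma HasMoments.const_mul (hF : HasMoments F μ) (c : ℝ) :
    HasMoments (fun x => c * F x) μ := fun n => (hF n).const_mul c

lemma HasMoments.sum {ι : Type*} (s : Finset ι) {f : ι → Ω → ℝ}
    (h : ∀ i ∈ s, HasMoments (f i) μ) : HasMoments (fun x => ∑ i ∈ s, f i x) μ :=
  fun n => memLp_finsetSum s fun i hi => h i hi n

lemma HasMoments.prod [IsFiniteMeasure μ] {ι : Type*} (s : Finset ι) {f : ι → Ω → ℝ}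
    (h : ∀ i ∈ s, HasMoments (f i) μ) : HasMoments (fun x => ∏ i ∈ s, f i x) μ := by
  classical
  induction s using Finset.induction_on with
  | empty => simpa using hasMoments_const 1
  | insert a s ha ih =>
    simp_rw [Finset.prod_insert ha]
    exact (h a (by simp)).mul (ih fun i hi => h i (by simp [hi]))

lemma HasMoments.pow [IsFiniteMeasure μ] (h : HasMoments F μ) (k : ℕ) :
    HasMoments (fun x => F x ^ k) μ := by
  simpa using HasMoments.prod (Finset.range k) (f := fun _ => F) fun _ _ => h

lemma HasMoments.eval [IsFiniteMeasure μ] (h : HasMoments F μ) (q : ℝ[X]) :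
    HasMoments (fun x => q.eval (F x)) μ := by
  simp_rw [eval_eq_sum_range]
  exact HasMoments.sum _ fun k _ => (h.pow k).const_mul _

lemma HasMoments.comp {ν : Measure Ω'} {φ : Ω' → Ω} (h : HasMoments F μ)
    (hφ : MeasurePreserving φ ν μ) : HasMoments (fun x => F (φ x)) ν :=
  fun n => (h n).comp_measurePreserving hφ

lemma hasMoments_map {φ : Ω → Ω'} {F : Ω' → ℝ} (hφ : Measurable φ) (hF : Measurable F) :
    HasMoments F (μ.map φ) ↔ HasMoments (fun x => F (φ x)) μ :=
  forall_congr' fun _ => memLp_map_measure_iff hF.aestronglyMeasurable hφ.aemeasurable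

end HasMoments

/-! ### Hermite polynomials and Gaussian integration by parts -/

lemma hasMoments_id_gaussianReal (m : ℝ) (s : ℝ≥0) : HasMoments (fun x => x) (gaussianReal m s) :=
  fun n => memLp_id_gaussianReal' n (by simp)

lemma integrable_eval_gaussianReal (q : ℝ[X]) (m : ℝ) (s : ℝ≥0) :
    Integrable (fun x => q.eval x) (gaussianReal m s) :=
  ((hasMoments_id_gaussianReal m s).eval q).integrable

lemma integrable_X_mul_eval_gaussianReal (q : ℝ[X]) (m : ℝ) (s : ℝ≥0) :
    Integrable (fun x => x * q.eval x) (gaussianReal m s) := by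
  refine (integrable_eval_gaussianReal (X * q) m s).congr (.of_forall fun x => ?_)
  simp

/-- Gaussian integration by parts (Stein's identity) against a polynomial:
`E[x q(x)] = m E[q(x)] + s E[q'(x)]` for `x ∼ N(m, s)`. -/
lemma integral_X_mul_gaussianReal (q : ℝ[X]) (m : ℝ) {s : ℝ≥0} (hs : s ≠ 0) :
    ∫ x, x * q.eval x ∂gaussianReal m s =
      m * ∫ x, q.eval x ∂gaussianReal m s + s * ∫ x, q.derivative.eval x ∂gaussianReal m s := by
  have hs' : (s : ℝ) ≠ 0 := by exact_mod_cast hs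
  have hint : ∀ r : ℝ[X], Integrable fun x => gaussianPDFReal m s x * r.eval x := by
    intro r
    have := integrable_eval_gaussianReal r m s
    rw [gaussianReal_of_var_ne_zero _ hs, integrable_withDensity_iff_integrable_smul'
      (measurable_gaussianPDF m s) (.of_forall fun _ => gaussianPDF_lt_top)] at this
    simpa [toReal_gaussianPDF] using this
  have hder : ∀ x, HasDerivAt (fun x => gaussianPDFReal m s x * q.eval x)
      (gaussianPDFReal m s x *
        (derivative q - C (s : ℝ)⁻¹ * (X - C m) * q).eval x) x := by
    intro x
    have h1 : HasDerivAt (fun x => gaussianPDFReal m s x)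
        (gaussianPDFReal m s x * (-((x - m) / s))) x := by
      have h := ((((hasDerivAt_id x).sub_const m).pow 2).neg.div_const (2 * (s : ℝ))).exp.const_mul
        (√(2 * Real.pi * s))⁻¹
      refine h.congr_deriv ?_
      simp [gaussianPDFReal_def]
      field_simp
    refine (h1.mul (q.hasDerivAt x)).congr_deriv ?_
    simp
    field_simp
    ring
  have h0 := integral_eq_zero_of_hasDerivAt_of_integrable hder (hint _) (hint q)
  have hI := fun r : ℝ[X] => integral_gaussianReal_eq_integral_smul (μ := m) hs
    (f := fun x => r.eval x)
  simp only [smul_eq_mul] at hI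
  rw [← hI] at h0
  have h2 : ∀ x, (derivative q - C (s : ℝ)⁻¹ * (X - C m) * q).eval x =
      (derivative q).eval x - ((s : ℝ)⁻¹ * (X * q).eval x - (s : ℝ)⁻¹ * m * q.eval x) := by
    intro x; simp; ring
  simp_rw [h2] at h0
  have i1 := integrable_eval_gaussianReal (derivative q) m s
  have i2 := integrable_eval_gaussianReal (X * q) m s
  have i3 := integrable_eval_gaussianReal q m s
  have j2 := i2.const_mul (s : ℝ)⁻¹
  have j3 := i3.const_mul ((s : ℝ)⁻¹ * m)
  have j4 : Integrable (fun x => (s : ℝ)⁻¹ * (X * q).eval x - (s : ℝ)⁻¹ * m * q.eval x)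
      (gaussianReal m s) := j2.sub j3
  rw [integral_sub i1 j4, integral_sub j2 j3, integral_const_mul, integral_const_mul] at h0
  simp only [eval_mul, eval_X] at h0
  field_simp at h0
  linarith

/-- The probabilists' Hermite polynomial with real coefficients: monic, not normalized. -/
def He (k : ℕ) : ℝ[X] := (hermite k).map (Int.castRingHom ℝ)

@[simp] lemma He_zero : He 0 = 1 := by simp [He]

lemma He_succ (k : ℕ) : He (k + 1) = X * He k - derivative (He k) := by
  simp [He, hermite_succ, Polynomial.derivative_map]

lemma monic_He (k : ℕ) : (He k).Monic := (hermite_monic k).map _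

lemma natDegree_He (k : ℕ) : (He k).natDegree = k := by
  rw [He, (hermite_monic k).natDegree_map, natDegree_hermite]

lemma derivative_He_succ (k : ℕ) : derivative (He (k + 1)) = ((k : ℝ[X]) + 1) * He k := by
  induction k with
  | zero => simp [He_succ]
  | succ k ih =>
    rw [He_succ (k + 1), derivative_sub, derivative_mul, derivative_X, ih, derivative_mul]
    simp only [derivative_add, derivative_natCast, derivative_one]
    rw [He_succ k]
    push_cast
    ring

lemma iterate_derivative_He (j i : ℕ) : derivative^[j] (He (j + i)) =
    C (((j + i).descFactorial j : ℕ) : ℝ) * He i := by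
  induction j with
  | zero => simp
  | succ j ih =>
    rw [Function.iterate_succ_apply, show j + 1 + i = j + i + 1 by ring, derivative_He_succ,
      Nat.succ_descFactorial_succ]
    rw [show ((j + i : ℕ) : ℝ[X]) + 1 = C ((j + i + 1 : ℕ) : ℝ) by simp,
      iterate_derivative_C_mul, ih]
    push_cast
    rw [C_mul]; ring

/-- Iterated integration by parts: pairing with `He k` under `N(0, 1)` is the same as integrating
the `k`-th derivative. Orthogonality, and annihilation of lower degrees, follow at once. -/
lemma integral_He_mul (k : ℕ) (q : ℝ[X]) :
    ∫ x, (He k).eval x * q.eval x ∂gaussianReal 0 1 =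
      ∫ x, (derivative^[k] q).eval x ∂gaussianReal 0 1 := by
  induction k generalizing q with
  | zero => simp
  | succ k ih =>
    have h := integral_X_mul_gaussianReal (He k * q) 0 one_ne_zero
    simp only [zero_mul, NNReal.coe_one, one_mul, zero_add, derivative_mul, eval_add] at h
    rw [integral_add (by simpa only [eval_mul] using integrable_eval_gaussianReal (derivative (He k) * q) 0 1)
      (by simpa only [eval_mul] using integrable_eval_gaussianReal (He k * derivative q) 0 1)] at h
    rw [Function.iterate_succ_apply, ← ih]
    have e : ∀ x, (He (k + 1)).eval x * q.eval x =
        x * (He k * q).eval x - (derivative (He k) * q).eval x := by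
      intro x; rw [He_succ]; simp; ring
    simp_rw [e]
    rw [integral_sub (integrable_X_mul_eval_gaussianReal _ _ _)
      (integrable_eval_gaussianReal _ _ _), h]
    simp

lemma integral_He_mul_eq_zero {k : ℕ} {q : ℝ[X]} (h : q.natDegree < k) :
    ∫ x, (He k).eval x * q.eval x ∂gaussianReal 0 1 = 0 := by
  rw [integral_He_mul, iterate_derivative_eq_zero h]; simp

lemma integral_He_eq_zero {k : ℕ} (h : 0 < k) : ∫ x, (He k).eval x ∂gaussianReal 0 1 = 0 := by
  simpa using integral_He_mul_eq_zero (q := 1) (k := k) (by simpa)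

lemma integral_He_mul_He (j k : ℕ) :
    ∫ x, (He j).eval x * (He k).eval x ∂gaussianReal 0 1 =
      if j = k then (k.factorial : ℝ) else 0 := by
  split_ifs with h
  · subst h
    rw [integral_He_mul]
    have := iterate_derivative_He j 0
    simp only [add_zero] at this
    rw [this]
    simp [Nat.descFactorial_self]
  · rcases lt_or_gt_of_ne h with h | h
    · simp_rw [mul_comm ((He j).eval _)]
      exact integral_He_mul_eq_zero (by rwa [natDegree_He])
    · exact integral_He_mul_eq_zero (by rwa [natDegree_He])

/-- The Hermite expansion of a polynomial. -/
lemma eq_sum_He {N : ℕ} {q : ℝ[X]} (hq : q.natDegree ≤ N) :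
    q = ∑ k ∈ Finset.range (N + 1),
      C ((∫ x, (He k).eval x * q.eval x ∂gaussianReal 0 1) / k.factorial) * He k := by
  have key : ∀ N : ℕ, ∀ q : ℝ[X], q.natDegree ≤ N → ∃ c : ℕ → ℝ,
      q = ∑ k ∈ Finset.range (N + 1), C (c k) * He k := by
    intro N
    induction N with
    | zero =>
      intro q hq
      refine ⟨fun _ => q.coeff 0, ?_⟩
      simpa using eq_C_of_natDegree_le_zero hq
    | succ N ih =>
      intro q hq
      have hdeg : (q - C (q.coeff (N + 1)) * He (N + 1)).natDegree ≤ N := by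
        rw [natDegree_le_iff_coeff_eq_zero]
        intro i hi
        rcases (Nat.succ_le_of_lt hi).eq_or_lt with rfl | hi
        · have : (He (N + 1)).coeff (N + 1) = 1 := by
            have := monic_He (N + 1)
            rwa [Monic, leadingCoeff, natDegree_He] at this
          simp [this]
        · rw [coeff_sub, coeff_C_mul, coeff_eq_zero_of_natDegree_lt (by omega),
            coeff_eq_zero_of_natDegree_lt (p := He (N + 1)) (by rw [natDegree_He]; omega)]
          simp
      obtain ⟨c, hc⟩ := ih _ hdeg
      refine ⟨fun k => if k = N + 1 then q.coeff (N + 1) else c k, ?_⟩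
      rw [Finset.sum_range_succ, Finset.sum_congr rfl (g := fun k => C (c k) * He k),
        ← hc]
      · simp
      · intro k hk
        have hne : k ≠ N + 1 := by have := Finset.mem_range.1 hk; omega
        simp only [if_neg hne]
  obtain ⟨c, hc⟩ := key N q hq
  have hcoef : ∀ k ∈ Finset.range (N + 1),
      (∫ x, (He k).eval x * q.eval x ∂gaussianReal 0 1) = c k * k.factorial := by
    intro k hk
    have e : ∀ x, (He k).eval x * q.eval x =
        ∑ j ∈ Finset.range (N + 1), c j * ((He k).eval x * (He j).eval x) := by
      intro x
      conv_lhs => rw [hc]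
      rw [eval_finsetSum, Finset.mul_sum]
      refine Finset.sum_congr rfl fun j _ => ?_
      simp; ring
    simp_rw [e]
    rw [integral_finsetSum _ fun j _ => Integrable.const_mul
      (by simpa only [eval_mul] using integrable_eval_gaussianReal (He k * He j) 0 1) _]
    simp_rw [integral_const_mul, integral_He_mul_He]
    simp only [mul_ite, mul_zero]
    rw [Finset.sum_ite_eq, if_pos hk]
  conv_lhs => rw [hc]
  refine Finset.sum_congr rfl fun k hk => ?_
  rw [hcoef k hk, mul_div_cancel_right₀ _ (by positivity)]

/-- The unnormalized Hermite coefficient `E_A[He_k]` of a distribution `A` on the line. -/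
def hermiteMoment (A : Measure ℝ) (k : ℕ) : ℝ := ∫ x, (He k).eval x ∂A

/-- On polynomials of degree at most `N`, a distribution `A` with finite moments acts like
`N(0, 1)` reweighted by the truncated Hermite series `∑_{k ≤ N} E_A[He_k] / k! · He_k`, whether or
not `A` has a density. -/
lemma integral_eval_eq_sum {A : Measure ℝ} [IsFiniteMeasure A] (hA : HasMoments (fun x => x) A)
    {N : ℕ} {q : ℝ[X]} (hq : q.natDegree ≤ N) :
    ∫ x, q.eval x ∂A = ∑ k ∈ Finset.range (N + 1), hermiteMoment A k / k.factorial *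
      ∫ x, q.eval x * (He k).eval x ∂gaussianReal 0 1 := by
  conv_lhs => rw [eq_sum_He hq]
  simp_rw [eval_finsetSum, eval_mul, eval_C]
  rw [integral_finsetSum _ fun j _ => ((hA.eval (He j)).integrable).const_mul _]
  refine Finset.sum_congr rfl fun k _ => ?_
  rw [integral_const_mul, hermiteMoment]
  simp_rw [mul_comm (q.eval _)]
  ring

/-- The Hermite recursion combined with Stein's identity. -/
lemma hermiteMoment_gaussianReal_succ_succ (m : ℝ) {s : ℝ≥0} (hs : s ≠ 0) (k : ℕ) :
    hermiteMoment (gaussianReal m s) (k + 2) = m * hermiteMoment (gaussianReal m s) (k + 1) +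
      (s - 1) * (k + 1) * hermiteMoment (gaussianReal m s) k := by
  unfold hermiteMoment
  have e : ∀ x, (He (k + 2)).eval x =
      x * (He (k + 1)).eval x - (derivative (He (k + 1))).eval x := by
    intro x; rw [He_succ (k + 1)]; simp
  simp_rw [e]
  rw [integral_sub (integrable_X_mul_eval_gaussianReal _ _ _)
    (integrable_eval_gaussianReal _ _ _), integral_X_mul_gaussianReal _ _ hs]
  simp_rw [derivative_He_succ]
  have : ∀ x, ((((k : ℝ[X]) + 1) * He k)).eval x = ((k : ℝ) + 1) * (He k).eval x := by
    intro x; simp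
  simp_rw [this, integral_const_mul]
  ring

@[simp] lemma hermiteMoment_zero (A : Measure ℝ) [IsProbabilityMeasure A] :
    hermiteMoment A 0 = 1 := by simp [hermiteMoment]

lemma hermiteMoment_gaussianReal_one (m : ℝ) (s : ℝ≥0) :
    hermiteMoment (gaussianReal m s) 1 = m := by
  simp [hermiteMoment, He, integral_id_gaussianReal]

lemma hermiteMoment_gaussianReal_var_one (m : ℝ) (k : ℕ) :
    hermiteMoment (gaussianReal m 1) k = m ^ k := by
  induction k using Nat.twoStepInduction with
  | zero => simp
  | one => simp [hermiteMoment_gaussianReal_one]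
  | more k _ ih =>
    rw [hermiteMoment_gaussianReal_succ_succ _ one_ne_zero, ih]; simp; ring

lemma hermiteMoment_gaussianReal_odd {s : ℝ≥0} (hs : s ≠ 0) {k : ℕ} (hk : Odd k) :
    hermiteMoment (gaussianReal 0 s) k = 0 := by
  obtain ⟨j, rfl⟩ := hk
  induction j with
  | zero => simp [hermiteMoment_gaussianReal_one]
  | succ j ih =>
    rw [show 2 * (j + 1) + 1 = 2 * j + 1 + 2 by ring, hermiteMoment_gaussianReal_succ_succ _ hs, ih]
    simp

/-- The exact value is `(s - 1)^j (2j - 1)!!`, and `(2j - 1)!!² ≤ (2j)!`. -/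
lemma sq_hermiteMoment_gaussianReal_even_le {s : ℝ≥0} (hs : s ≠ 0) (j : ℕ) :
    hermiteMoment (gaussianReal 0 s) (2 * j) ^ 2 ≤
      ((s - 1 : ℝ) ^ 2) ^ j * (2 * j).factorial := by
  induction j with
  | zero => simp
  | succ j ih =>
    rw [show 2 * (j + 1) = 2 * j + 2 by ring, hermiteMoment_gaussianReal_succ_succ _ hs,
      Nat.factorial_succ, Nat.factorial_succ]
    push_cast
    calc _ = (s - 1 : ℝ) ^ 2 * (2 * j + 1) ^ 2 * hermiteMoment (gaussianReal 0 s) (2 * j) ^ 2 := by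
          ring
      _ ≤ (s - 1 : ℝ) ^ 2 * (2 * j + 1) ^ 2 * (((s - 1 : ℝ) ^ 2) ^ j * (2 * j).factorial) := by
          gcongr
      _ ≤ (s - 1 : ℝ) ^ 2 * ((2 * j + 1 + 1) * (2 * j + 1)) *
          (((s - 1 : ℝ) ^ 2) ^ j * (2 * j).factorial) := by
          gcongr
          nlinarith
      _ = _ := by ring

lemma integral_pow_gaussianReal_le {D : ℝ} (j : ℕ) (hD : (2 * j : ℝ) ≤ D) :
    ∫ x, x ^ (2 * j) ∂gaussianReal 0 1 ≤ D ^ j := by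
  induction j with
  | zero => simp
  | succ j ih =>
    push_cast at hD
    have h := integral_X_mul_gaussianReal (X ^ (2 * j + 1)) 0 one_ne_zero
    simp only [derivative_X_pow, eval_pow, eval_X, zero_mul, zero_add, NNReal.coe_one, one_mul,
      eval_mul, Nat.add_sub_cancel, map_natCast, eval_natCast] at h
    rw [integral_const_mul] at h
    have e : ∀ x : ℝ, x ^ (2 * (j + 1)) = x * x ^ (2 * j + 1) := by intro x; ring
    simp_rw [e]
    rw [h, pow_succ']
    have : (0:ℝ) ≤ ∫ x, x ^ (2 * j) ∂gaussianReal 0 1 :=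
      integral_nonneg fun x => by simpa [pow_mul] using pow_nonneg (sq_nonneg x) j
    exact mul_le_mul (by push_cast; linarith) (ih (by linarith)) this (by linarith)

variable {d n : ℕ}

/-! ### Hidden-direction distributions -/

/-- The point `t v + (g - ⟨v, g⟩ v)` with component `t` along `v` and the same orthogonal
component as `g`, where `p = (t, g)`. -/
def place (v : Sphere d) (p : ℝ × Space d) : Space d :=
  p.1 • (v : Space d) + (p.2 - inner ℝ (v : Space d) p.2 • (v : Space d))

lemma measurable_place (v : Sphere d) : Measurable (place v) := by
  unfold place; fun_prop

lemma hiddenDirection_eq_map (A : Measure ℝ) (v : Sphere d) :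
    hiddenDirection A v = (A.prod (stdGaussian (Space d))).map (place v) := rfl

lemma inner_self_sphere (v : Sphere d) : inner ℝ (v : Space d) v = 1 := by
  rw [real_inner_self_eq_norm_sq, norm_eq_of_mem_sphere]; norm_num

lemma inner_place (u v : Sphere d) (p : ℝ × Space d) : inner ℝ (u : Space d) (place v p) =
    inner ℝ (u : Space d) v * p.1 + (inner ℝ (u : Space d) p.2 -
      inner ℝ (u : Space d) v * inner ℝ (v : Space d) p.2) := by
  simp only [place, inner_add_right, inner_sub_right, inner_smul_right]
  ring

lemma inner_place_self (v : Sphere d) (p : ℝ × Space d) :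
    inner ℝ (v : Space d) (place v p) = p.1 := by
  rw [inner_place, inner_self_sphere]; ring

lemma norm_sub_inner_smul_sq (v : Sphere d) (x : Space d) :
    ‖x - inner ℝ (v : Space d) x • (v : Space d)‖ ^ 2 = ‖x‖ ^ 2 - inner ℝ (v : Space d) x ^ 2 := by
  rw [norm_sub_sq_real, norm_smul, inner_smul_right, real_inner_comm, norm_eq_of_mem_sphere]
  simp
  ring

instance (A : Measure ℝ) [IsProbabilityMeasure A] (v : Sphere d) :
    IsProbabilityMeasure (hiddenDirection A v) :=
  Measure.isProbabilityMeasure_map (measurable_place v).aemeasurable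

lemma charFun_hiddenDirection (A : Measure ℝ) [IsProbabilityMeasure A] (v : Sphere d)
    (x : Space d) : charFun (hiddenDirection A v) x =
      charFun A (inner ℝ (v : Space d) x) *
        charFun (stdGaussian (Space d)) (x - inner ℝ (v : Space d) x • (v : Space d)) := by
  rw [hiddenDirection_eq_map, charFun_apply, integral_map (measurable_place v).aemeasurable
    (Measurable.aestronglyMeasurable (by fun_prop)), charFun_apply, charFun_apply,
    ← integral_prod_mul]
  refine integral_congr_ae (.of_forall fun p => ?_)
  simp only
  rw [← Complex.exp_add, ← add_mul, ← Complex.ofReal_add]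
  congr 4
  simp only [place, inner_add_left, inner_sub_left, inner_smul_left, inner_sub_right,
    inner_smul_right, real_inner_comm]
  simp
  rw [real_inner_comm p.2 (v : Space d)]
  ring

lemma inlier_quadratic_form (α : ℝ) (v : Sphere d) (x : Space d) :
    (x : Fin d → ℝ) ⬝ᵥ (1 - α • Matrix.vecMulVec (fun i => (v : Space d) i)
      (fun i => (v : Space d) i)).mulVec x = ‖x‖ ^ 2 - α * inner ℝ (v : Space d) x ^ 2 := by
  have h1 : (fun i => (v : Space d) i) ⬝ᵥ (x : Fin d → ℝ) = inner ℝ (v : Space d) x := by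
    simp [PiLp.inner_apply, dotProduct, mul_comm]
  have h2 : (x : Fin d → ℝ) ⬝ᵥ (x : Fin d → ℝ) = ‖x‖ ^ 2 := by
    rw [EuclideanSpace.real_norm_sq_eq]
    simp only [dotProduct, sq]
  rw [Matrix.sub_mulVec, Matrix.one_mulVec, dotProduct_sub, h2, Matrix.smul_mulVec,
    Matrix.vecMulVec_mulVec, h1, dotProduct_smul]
  simp only [op_smul_eq_smul, dotProduct_smul]
  rw [dotProduct_comm, h1]
  simp only [smul_eq_mul]; ring

lemma inner_sq_le (v : Sphere d) (x : Space d) : inner ℝ (v : Space d) x ^ 2 ≤ ‖x‖ ^ 2 := by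
  have := sq_nonneg ‖x - inner ℝ (v : Space d) x • (v : Space d)‖
  rw [norm_sub_inner_smul_sq] at this
  linarith

lemma posSemidef_inlier_covariance {α : ℝ} (hα : α ≤ 1) (v : Sphere d) :
    (1 - α • Matrix.vecMulVec (fun i => (v : Space d) i) (fun i => (v : Space d) i)).PosSemidef := by
  refine Matrix.PosSemidef.of_dotProduct_mulVec_nonneg ?_ fun x => ?_
  · ext i j
    simp [Matrix.vecMulVec_apply, Matrix.one_apply, eq_comm, mul_comm]
  · have h := inlier_quadratic_form α v (WithLp.toLp 2 x)
    simp only [star_trivial]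
    simp only at h
    rw [h]
    have := inner_sq_le v (WithLp.toLp 2 x)
    have h0 := sq_nonneg (inner ℝ (v : Space d) (WithLp.toLp 2 x))
    nlinarith

lemma hiddenDirection_gaussianReal {α : ℝ} (hα : α ≤ 1) (v : Sphere d) :
    hiddenDirection (gaussianReal 0 (1 - α).toNNReal) v = inlier α v := by
  have : IsProbabilityMeasure (inlier α v) := by unfold inlier; infer_instance
  refine Measure.ext_of_charFun (funext fun x => ?_)
  rw [charFun_hiddenDirection, inlier, charFun_multivariateGaussian
    (posSemidef_inlier_covariance hα v), charFun_gaussianReal, charFun_stdGaussian,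
    inlier_quadratic_form, ← Complex.exp_add, ← Complex.ofReal_pow (‖_‖), norm_sub_inner_smul_sq,
    Real.coe_toNNReal _ (by linarith)]
  congr 1
  push_cast
  simp
  ring

lemma hiddenDirection_gaussianReal_one (v : Sphere d) :
    hiddenDirection (gaussianReal 0 1) v = stdGaussian (Space d) := by
  have := hiddenDirection_gaussianReal (α := 0) zero_le_one v
  simpa [inlier] using this

lemma measurePreserving_place (v : Sphere d) : MeasurePreserving (place v)
    ((gaussianReal 0 1).prod (stdGaussian (Space d))) (stdGaussian (Space d)) :=
  ⟨measurable_place v, hiddenDirection_gaussianReal_one v⟩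

lemma measurePreserving_inner (v : Sphere d) :
    MeasurePreserving (fun y => inner ℝ (v : Space d) y) (stdGaussian (Space d))
      (gaussianReal 0 1) := by
  refine ⟨by fun_prop, ?_⟩
  rw [← hiddenDirection_gaussianReal_one v, hiddenDirection_eq_map,
    Measure.map_map (by fun_prop) (measurable_place v)]
  have : (fun y => inner ℝ (v : Space d) y) ∘ place v = Prod.fst :=
    funext fun p => inner_place_self v p
  rw [this]
  exact measurePreserving_fst.map_eq

lemma hiddenDirection_mix (w : ℝ) (A A' : Measure ℝ) [IsFiniteMeasure A] [IsFiniteMeasure A']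
    (v : Sphere d) : hiddenDirection (mix w A A') v =
      mix w (hiddenDirection A v) (hiddenDirection A' v) := by
  simp only [hiddenDirection_eq_map, mix]
  rw [Measure.add_prod, Measure.map_add _ _ (measurable_place v), Measure.prod_smul_left,
    Measure.prod_smul_left, Measure.map_smul, Measure.map_smul]

lemma hasMoments_norm_stdGaussian : HasMoments (fun y => ‖y‖) (stdGaussian (Space d)) :=
  fun n => (IsGaussian.memLp_id (stdGaussian (Space d)) n (by simp)).norm

/-! ### Moments of the uniform distribution on the sphere -/

/-- Polar coordinates for a product of an angular and a radial function. No integrability is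
needed, since the integral of a product of functions of separate variables always factors. -/
lemma integral_polar (f : Sphere d → ℝ) (h : ℝ → ℝ) :
    ∫ y : {y : Space d // y ∈ ({0}ᶜ : Set (Space d))},
      f (homeomorphUnitSphereProd (Space d) y).1 * h ‖y.1‖ ∂(volume.comap Subtype.val) =
    (∫ v, f v ∂(volume : Measure (Space d)).toSphere) *
      ∫ r, h r.1 ∂Measure.volumeIoiPow (Module.finrank ℝ (Space d) - 1) := by
  have := ((volume : Measure (Space d)).measurePreserving_homeomorphUnitSphereProd).integral_comp
    (homeomorphUnitSphereProd (Space d)).measurableEmbedding (fun p => f p.1 * h p.2.1)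
  rw [integral_prod_mul (fun v => f v) (fun r : Set.Ioi (0:ℝ) => h r.1)] at this
  rw [← this]
  simp

lemma integral_inner_pow_mul_radial [Nonempty (Fin d)] (u : Space d) (k : ℕ) (h : ℝ → ℝ) :
    ∫ y : Space d, inner ℝ u y ^ k * h ‖y‖ =
      (∫ v : Sphere d, inner ℝ u (v : Space d) ^ k ∂(volume : Measure (Space d)).toSphere) *
      ∫ r, r.1 ^ k * h r.1 ∂Measure.volumeIoiPow (Module.finrank ℝ (Space d) - 1) := by
  rw [← integral_polar (fun v : Sphere d => inner ℝ u (v : Space d) ^ k) (fun r => r ^ k * h r)]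
  have e : ∀ y : {y : Space d // y ∈ ({0}ᶜ : Set (Space d))},
      inner ℝ u ((homeomorphUnitSphereProd (Space d) y).1 : Space d) ^ k *
        (‖y.1‖ ^ k * h ‖y.1‖) = inner ℝ u y.1 ^ k * h ‖y.1‖ := by
    intro y
    have hy : ‖y.1‖ ≠ 0 := norm_ne_zero_iff.2 y.2
    rw [homeomorphUnitSphereProd_apply_fst_coe, inner_smul_right, ← mul_assoc, ← mul_pow]
    congr 2
    field_simp
  simp_rw [e]
  rw [integral_subtype_comap (measurableSet_singleton _).compl
    (fun y : Space d => inner ℝ u y ^ k * h ‖y‖), restrict_compl_singleton]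

/-- The constant that turns `exp (-‖y‖² / 2)` into a probability density on `ℝ^d`. -/
def gaussianNormalization (d : ℕ) : ℝ := (∫ y : Space d, Real.exp (-(1 / 2) * ‖y‖ ^ 2))⁻¹

lemma gaussianIntegral_pos : 0 < ∫ y : Space d, Real.exp (-(1 / 2) * ‖y‖ ^ 2) := by
  rw [GaussianFourier.integral_rexp_neg_mul_sq_norm (by norm_num)]
  positivity

lemma stdGaussian_eq_withDensity : stdGaussian (Space d) = volume.withDensity
    fun y : Space d => ENNReal.ofReal (gaussianNormalization d *
      Real.exp (-(1 / 2) * ‖y‖ ^ 2)) := by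
  have hpos : 0 < gaussianNormalization d := inv_pos.2 gaussianIntegral_pos
  have hint : Integrable (fun y : Space d => Real.exp (-(1 / 2) * ‖y‖ ^ 2)) :=
    not_imp_comm.1 integral_undef gaussianIntegral_pos.ne'
  have hfin : IsFiniteMeasure (volume.withDensity
      fun y : Space d => ENNReal.ofReal (gaussianNormalization d *
        Real.exp (-(1 / 2) * ‖y‖ ^ 2))) :=
    isFiniteMeasure_withDensity_ofReal (hint.const_mul _).2
  refine Measure.ext_of_charFun (funext fun x => ?_)
  rw [charFun_stdGaussian, charFun_apply, integral_withDensity_eq_integral_toReal_smul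
    (by fun_prop) (.of_forall fun _ => ENNReal.ofReal_lt_top)]
  have h1 := GaussianFourier.integral_cexp_neg_mul_sq_norm_add (V := Space d) (b := 1 / 2)
    (by norm_num) Complex.I x
  have h0 : ((∫ y : Space d, Real.exp (-(1 / 2) * ‖y‖ ^ 2) : ℝ) : ℂ) =
      (Real.pi / (1 / 2)) ^ (Module.finrank ℝ (Space d) / 2 : ℂ) := by
    rw [← GaussianFourier.integral_cexp_neg_mul_sq_norm (V := Space d) (b := 1 / 2) (by norm_num),
      ← integral_complex_ofReal]
    congr with y
    push_cast
    rfl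
  rw [← h0] at h1
  have e : ∀ y : Space d, (ENNReal.ofReal (gaussianNormalization d *
      Real.exp (-(1 / 2) * ‖y‖ ^ 2))).toReal • Complex.exp (inner ℝ y x * Complex.I) =
      gaussianNormalization d *
        Complex.exp (-(1 / 2) * ‖y‖ ^ 2 + Complex.I * inner ℝ x y) := by
    intro y
    rw [ENNReal.toReal_ofReal (by positivity), Complex.real_smul, Complex.exp_add,
      real_inner_comm, mul_comm Complex.I]
    push_cast
    ring
  simp_rw [e]
  rw [integral_const_mul, h1, ← mul_assoc, ← Complex.ofReal_mul, gaussianNormalization,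
    inv_mul_cancel₀ gaussianIntegral_pos.ne']
  simp
  congr 1
  ring

lemma integral_stdGaussian_eq (F : Space d → ℝ) : ∫ y, F y ∂stdGaussian (Space d) =
    gaussianNormalization d * ∫ y, F y * Real.exp (-(1 / 2) * ‖y‖ ^ 2) := by
  have hpos : 0 < gaussianNormalization d := inv_pos.2 gaussianIntegral_pos
  rw [stdGaussian_eq_withDensity, integral_withDensity_eq_integral_toReal_smul
    (by fun_prop) (.of_forall fun _ => ENNReal.ofReal_lt_top), ← integral_const_mul]
  refine integral_congr_ae (.of_forall fun y => ?_)
  simp only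
  rw [ENNReal.toReal_ofReal (by positivity), smul_eq_mul]
  ring

lemma isProbabilityMeasure_uniformSphere (hd : 0 < d) :
    IsProbabilityMeasure (uniformSphere d) := by
  have : Nonempty (Fin d) := ⟨⟨0, hd⟩⟩
  have : Nontrivial (Space d) := inferInstance
  have : NeZero (volume : Measure (Space d)).toSphere := ⟨Measure.toSphere_ne_zero _⟩
  exact isProbabilityMeasureSMul

/-- The direction of a standard Gaussian vector is uniform on the sphere and independent of its
norm; at the level of moments of a linear form. -/
lemma integral_inner_pow_stdGaussian (hd : 0 < d) (u : Space d) (k : ℕ) :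
    ∫ y, inner ℝ u y ^ k ∂stdGaussian (Space d) =
      (∫ v, inner ℝ u (v : Space d) ^ k ∂uniformSphere d) *
        ∫ y, ‖y‖ ^ k ∂stdGaussian (Space d) := by
  have : Nonempty (Fin d) := ⟨⟨0, hd⟩⟩
  have hne : (volume : Measure (Space d)).toSphere.real Set.univ ≠ 0 := by
    rw [Measure.real, ENNReal.toReal_ne_zero]
    exact ⟨fun h => Measure.toSphere_ne_zero (volume : Measure (Space d))
      (Measure.measure_univ_eq_zero.1 h),
      measure_ne_top _ _⟩
  have h1 := integral_inner_pow_mul_radial u k fun r => Real.exp (-(1 / 2) * r ^ 2)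
  have h2 := integral_inner_pow_mul_radial u 0 fun r => r ^ k * Real.exp (-(1 / 2) * r ^ 2)
  simp only [pow_zero, one_mul, integral_const, smul_eq_mul, mul_one] at h2
  rw [integral_stdGaussian_eq, integral_stdGaussian_eq, h1, h2, uniformSphere,
    integral_smul_measure, ENNReal.toReal_inv, ← Measure.real, smul_eq_mul]
  field_simp

lemma integral_norm_sq_stdGaussian : ∫ y, ‖y‖ ^ 2 ∂stdGaussian (Space d) = d := by
  simp_rw [EuclideanSpace.real_norm_sq_eq]
  have key : ∀ i : Fin d, MeasurePreserving (fun y : Space d => y i) (stdGaussian (Space d))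
      (gaussianReal 0 1) := by
    intro i
    have := measurePreserving_inner (d := d) ⟨EuclideanSpace.single i 1, by simp⟩
    simpa [EuclideanSpace.inner_single_left] using this
  have hm : ∀ i : Fin d, HasMoments (fun y : Space d => y i) (stdGaussian (Space d)) :=
    fun i => (hasMoments_id_gaussianReal 0 1).comp (key i)
  rw [integral_finsetSum _ fun i _ => ((hm i).pow 2).integrable]
  have h2 : ∫ x : ℝ, x ^ 2 ∂gaussianReal 0 1 = 1 := by
    have := integral_X_mul_gaussianReal Polynomial.X 0 (s := 1) one_ne_zero
    simpa [sq] using this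
  have : ∀ i : Fin d, ∫ y : Space d, y i ^ 2 ∂stdGaussian (Space d) = 1 := by
    intro i
    rw [← h2, ← (key i).map_eq, integral_map (key i).measurable.aemeasurable
      (by fun_prop)]
  simp [this]

/-- Jensen's inequality applied to `E‖y‖² = d`. -/
lemma pow_le_integral_norm_pow (m : ℕ) :
    (d : ℝ) ^ m ≤ ∫ y, ‖y‖ ^ (2 * m) ∂stdGaussian (Space d) := by
  have h := (convexOn_pow m).map_integral_le (μ := stdGaussian (Space d)) (f := fun y => ‖y‖ ^ 2)
    (by fun_prop) isClosed_Ici (.of_forall fun y => by simp)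
    (hasMoments_norm_stdGaussian.pow 2).integrable
    (by simpa [← pow_mul, Function.comp_def] using
      (hasMoments_norm_stdGaussian.pow (2 * m)).integrable)
  rw [integral_norm_sq_stdGaussian] at h
  simpa [← pow_mul] using h

/-- Even moments of a coordinate of a uniform unit vector: `(2m - 1)!!` divided by
`E‖y‖^{2m} ≥ d^m`. -/
lemma integral_inner_pow_uniformSphere_le (hd : 0 < d) (u : Sphere d) {D : ℝ} {m : ℕ}
    (hm : (2 * m : ℝ) ≤ D) :
    ∫ v, inner ℝ (u : Space d) (v : Space d) ^ (2 * m) ∂uniformSphere d ≤ (D / d) ^ m := by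
  have h := integral_inner_pow_stdGaussian hd (u : Space d) (2 * m)
  have h1 : ∫ y, inner ℝ (u : Space d) y ^ (2 * m) ∂stdGaussian (Space d) ≤ D ^ m := by
    refine le_trans (le_of_eq ?_) (integral_pow_gaussianReal_le m hm)
    rw [← (measurePreserving_inner u).map_eq, integral_map (by fun_prop) (by fun_prop)]
  have h2 := pow_le_integral_norm_pow (d := d) m
  have h3 : 0 ≤ ∫ v, inner ℝ (u : Space d) (v : Space d) ^ (2 * m) ∂uniformSphere d :=
    integral_nonneg fun v => by simpa [pow_mul] using pow_nonneg (sq_nonneg _) m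
  rw [div_pow, le_div_iff₀ (by positivity)]
  calc _ ≤ _ := mul_le_mul_of_nonneg_left h2 h3
    _ ≤ _ := h ▸ h1

/-! ### Low-degree likelihood ratios -/

lemma hasMoments_coord_stdGaussian (j : Fin d) :
    HasMoments (fun y : Space d => y j) (stdGaussian (Space d)) :=
  hasMoments_norm_stdGaussian.mono (by fun_prop) fun y => by
    simpa using PiLp.norm_apply_le y j

lemma hasMoments_inner_stdGaussian (v : Sphere d) :
    HasMoments (fun y => inner ℝ (v : Space d) y) (stdGaussian (Space d)) :=
  (hasMoments_id_gaussianReal 0 1).comp (measurePreserving_inner v)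

section Line
variable {A : Measure ℝ} [IsProbabilityMeasure A]

lemma hasMoments_place_coord (hA : HasMoments (fun x => x) A) (v : Sphere d) (j : Fin d) :
    HasMoments (fun p : ℝ × Space d => place v p j) (A.prod (stdGaussian (Space d))) := by
  have h1 := (hA.comp (measurePreserving_fst (μ := A) (ν := stdGaussian (Space d)))).const_mul
    ((v : Space d) j)
  have h2 := (hasMoments_coord_stdGaussian j).comp
    (measurePreserving_snd (μ := A) (ν := stdGaussian (Space d)))
  have h3 := ((hasMoments_inner_stdGaussian v).comp
    (measurePreserving_snd (μ := A) (ν := stdGaussian (Space d)))).const_mul (-(v : Space d) j)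
  convert (h1.add h2).add h3 using 2 with p
  simp [place]
  ring

lemma hasMoments_coord_hiddenDirection (hA : HasMoments (fun x => x) A) (v : Sphere d)
    (j : Fin d) : HasMoments (fun y : Space d => y j) (hiddenDirection A v) := by
  rw [hiddenDirection_eq_map, hasMoments_map (measurable_place v) (by fun_prop)]
  exact hasMoments_place_coord hA v j

/-- Along the direction `v`, a monomial of degree `e` is a polynomial of degree at most `e`. -/
lemma exists_eval_place_eq_prod_pow (v : Sphere d) (e : Fin d → ℕ) (g : Space d) :
    ∃ q : ℝ[X], q.natDegree ≤ ∑ j, e j ∧ ∀ t, ∏ j, place v (t, g) j ^ e j = q.eval t := by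
  refine ⟨∏ j, (C ((v : Space d) j) * X +
    C ((g - inner ℝ (v : Space d) g • (v : Space d)) j)) ^ e j, ?_, fun t => ?_⟩
  · refine (natDegree_prod_le _ _).trans (Finset.sum_le_sum fun j _ => ?_)
    exact (natDegree_pow_le_of_le (e j) natDegree_linear_le).trans (by simp)
  · rw [eval_prod]
    refine Finset.prod_congr rfl fun j _ => ?_
    simp only [place, PiLp.add_apply, PiLp.smul_apply, smul_eq_mul, eval_pow, eval_add, eval_mul,
      eval_C, eval_X, mul_comm t]

/-- Moments of one hidden-direction sample, expressed through the standard Gaussian. -/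
lemma integral_prod_pow_hiddenDirection (hA : HasMoments (fun x => x) A) (v : Sphere d)
    {e : Fin d → ℕ} {N : ℕ} (he : ∑ j, e j ≤ N) :
    ∫ y, ∏ j, y j ^ e j ∂hiddenDirection A v =
      ∑ k ∈ Finset.range (N + 1), hermiteMoment A k / k.factorial *
        ∫ y, (∏ j, y j ^ e j) * (He k).eval (inner ℝ (v : Space d) y) ∂stdGaussian (Space d) := by
  have hγ := hasMoments_id_gaussianReal 0 1
  have hint : ∀ k, Integrable (fun p : ℝ × Space d => (∏ j, place v p j ^ e j) * (He k).eval p.1)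
      ((gaussianReal 0 1).prod (stdGaussian (Space d))) := fun k =>
    ((HasMoments.prod _ fun j _ => (hasMoments_place_coord hγ v j).pow (e j)).mul
      ((hγ.comp measurePreserving_fst).eval (He k))).integrable
  have hk : ∀ k, ∫ y, (∏ j, y j ^ e j) * (He k).eval (inner ℝ (v : Space d) y)
      ∂stdGaussian (Space d) = ∫ g, ∫ t, (∏ j, place v (t, g) j ^ e j) * (He k).eval t
        ∂gaussianReal 0 1 ∂stdGaussian (Space d) := by
    intro k
    rw [← integral_prod_symm _ (hint k), ← (measurePreserving_place v).map_eq,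
      integral_map (measurable_place v).aemeasurable
        (Continuous.aestronglyMeasurable (by fun_prop))]
    simp_rw [inner_place_self]
    rw [(measurePreserving_place v).map_eq]
  simp_rw [hk]
  rw [hiddenDirection_eq_map, integral_map (measurable_place v).aemeasurable
    (Continuous.aestronglyMeasurable (by fun_prop)), integral_prod_symm _
    (HasMoments.prod _ fun j _ => (hasMoments_place_coord hA v j).pow (e j)).integrable]
  simp_rw [← integral_const_mul]
  rw [← integral_finsetSum _ fun k _ => by
    simp_rw [integral_const_mul]
    exact ((hint k).integral_prod_right).const_mul _]
  refine integral_congr_ae (.of_forall fun g => ?_)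
  obtain ⟨q, hq, hqe⟩ := exists_eval_place_eq_prod_pow v e g
  simp only [hqe, integral_const_mul]
  exact integral_eval_eq_sum hA (hq.trans he)

lemma integral_prod_pow_mul_He_eq_zero (v : Sphere d) {e : Fin d → ℕ} {k : ℕ}
    (he : ∑ j, e j < k) :
    ∫ y, (∏ j, y j ^ e j) * (He k).eval (inner ℝ (v : Space d) y) ∂stdGaussian (Space d) = 0 := by
  have hγ := hasMoments_id_gaussianReal 0 1
  have hint : Integrable (fun p : ℝ × Space d => (∏ j, place v p j ^ e j) * (He k).eval p.1)
      ((gaussianReal 0 1).prod (stdGaussian (Space d))) :=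
    ((HasMoments.prod _ fun j _ => (hasMoments_place_coord hγ v j).pow (e j)).mul
      ((hγ.comp measurePreserving_fst).eval (He k))).integrable
  rw [← (measurePreserving_place v).map_eq,
      integral_map (measurable_place v).aemeasurable
        (Continuous.aestronglyMeasurable (by fun_prop))]
  simp_rw [inner_place_self]
  rw [integral_prod_symm _ hint]
  refine (integral_congr_ae (.of_forall fun g => ?_)).trans (integral_zero _ _)
  obtain ⟨q, hq, hqe⟩ := exists_eval_place_eq_prod_pow v e g
  simp only [hqe]
  simp_rw [mul_comm (q.eval _)]
  exact integral_He_mul_eq_zero (hq.trans_lt he)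

end Line

lemma iterate_derivative_comp_linear (q : ℝ[X]) (a b : ℝ) (j : ℕ) :
    derivative^[j] (q.comp (C a * X + C b)) =
      C (a ^ j) * (derivative^[j] q).comp (C a * X + C b) := by
  induction j generalizing q with
  | zero => simp
  | succ j ih =>
    rw [Function.iterate_succ_apply, derivative_comp, Function.iterate_succ_apply]
    simp only [derivative_add, derivative_mul, derivative_C, zero_mul, derivative_X, mul_one,
      zero_add, add_zero]
    rw [iterate_derivative_C_mul, ih, pow_succ, C_mul]
    ring

/-- Hermite polynomials of two standard Gaussians with correlation `⟨u, v⟩` are orthogonal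
across degrees, and have covariance `k! ⟨u, v⟩^k` in degree `k`. -/
lemma integral_He_inner_mul_He_inner (u v : Sphere d) (j k : ℕ) :
    ∫ y, (He j).eval (inner ℝ (u : Space d) y) * (He k).eval (inner ℝ (v : Space d) y)
      ∂stdGaussian (Space d) =
      if j = k then (k.factorial : ℝ) * inner ℝ (u : Space d) (v : Space d) ^ k else 0 := by
  have hγ := hasMoments_id_gaussianReal 0 1
  have hmv : HasMoments (fun p => inner ℝ (v : Space d) (place u p))
      ((gaussianReal 0 1).prod (stdGaussian (Space d))) :=
    (hasMoments_inner_stdGaussian v).comp (measurePreserving_place u)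
  have hint : Integrable (fun p : ℝ × Space d => (He j).eval p.1 *
      (He k).eval (inner ℝ (v : Space d) (place u p)))
      ((gaussianReal 0 1).prod (stdGaussian (Space d))) :=
    (((hγ.comp measurePreserving_fst).eval (He j)).mul (hmv.eval (He k))).integrable
  set ρ : ℝ := inner ℝ (u : Space d) (v : Space d) with hρ
  let b : Space d → ℝ := fun g => inner ℝ (v : Space d) g - ρ * inner ℝ (u : Space d) g
  have hline : ∀ t g, inner ℝ (v : Space d) (place u (t, g)) = ρ * t + b g := by
    intro t g
    rw [inner_place, real_inner_comm]
  rw [← (measurePreserving_place u).map_eq,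
      integral_map (measurable_place u).aemeasurable
        (Continuous.aestronglyMeasurable (by fun_prop))]
  simp_rw [inner_place_self]
  rw [integral_prod_symm _ hint]
  have hin : ∀ g, ∫ t, (He j).eval t * (He k).eval (inner ℝ (v : Space d) (place u (t, g)))
      ∂gaussianReal 0 1 = ρ ^ j * ∫ t, (derivative^[j] (He k)).eval
        (inner ℝ (v : Space d) (place u (t, g))) ∂gaussianReal 0 1 := by
    intro g
    have h := integral_He_mul j ((He k).comp (C ρ * X + C (b g)))
    rw [iterate_derivative_comp_linear] at h
    simp only [eval_comp, eval_add, eval_mul, eval_C, eval_X, integral_const_mul] at h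
    simp_rw [hline]
    exact h
  simp only [hin]
  rw [integral_const_mul, ← integral_prod_symm (fun p : ℝ × Space d =>
    (derivative^[j] (He k)).eval (inner ℝ (v : Space d) (place u p)))
    (hmv.eval _).integrable,
    ← integral_map (φ := place u) (f := fun y => (derivative^[j] (He k)).eval
      (inner ℝ (v : Space d) y)) (measurable_place u).aemeasurable
        (Continuous.aestronglyMeasurable (by fun_prop)), (measurePreserving_place u).map_eq,
    ← integral_map (φ := fun y => inner ℝ (v : Space d) y)
      (f := fun x => (derivative^[j] (He k)).eval x) (by fun_prop)
        (Continuous.aestronglyMeasurable (by fun_prop)), (measurePreserving_inner v).map_eq]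
  rcases lt_or_ge k j with h | h
  · rw [iterate_derivative_eq_zero (by rwa [natDegree_He]), if_neg h.ne']
    simp
  · obtain ⟨i, rfl⟩ := Nat.exists_eq_add_of_le h
    rw [iterate_derivative_He]
    simp only [eval_mul, eval_C, integral_const_mul]
    rcases Nat.eq_zero_or_pos i with rfl | hi
    · simp [Nat.descFactorial_self, mul_comm]
    · rw [integral_He_eq_zero hi, if_neg (by omega)]
      simp

/-- The multi-degrees `K` on `n` samples of total degree at most `D`. The bound `K i ≤ D` is
implied by the total one; it makes the set finite. -/
def degreeProfiles (n D : ℕ) : Finset (Fin n → ℕ) :=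
  (Fintype.piFinset fun _ => Finset.range (D + 1)).filter fun K => ∑ i, K i ≤ D

/-- The part of degree at most `D` of the formal likelihood ratio of `n` samples from `P_{A,v}`
against `n` standard Gaussian samples, given by its Hermite expansion. -/
def lowDegreeRatio (A : Measure ℝ) (D : ℕ) (v : Sphere d) (y : Sample n d) : ℝ :=
  ∑ K ∈ degreeProfiles n D, ∏ i, hermiteMoment A (K i) / (K i).factorial *
    (He (K i)).eval (inner ℝ (v : Space d) (y i))

lemma evalAt_eq_sum (f : Poly n d) (y : Sample n d) :
    evalAt f y = ∑ s ∈ f.support, f.coeff s * ∏ i, ∏ j, y i j ^ s (i, j) := by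
  rw [evalAt, MvPolynomial.eval_eq']
  simp_rw [Fintype.prod_prod_type]

lemma sum_le_of_mem_support {f : Poly n d} {D : ℕ} (hf : f.totalDegree ≤ D)
    {s : Fin n × Fin d →₀ ℕ} (hs : s ∈ f.support) : ∑ i, ∑ j, s (i, j) ≤ D := by
  refine le_trans ?_ hf
  refine le_trans (le_of_eq ?_) (MvPolynomial.le_totalDegree hs)
  rw [Finsupp.sum_fintype _ _ fun _ => rfl, Fintype.sum_prod_type]

section Sample
variable {ν : Measure (Space d)} [IsProbabilityMeasure ν]

lemma hasMoments_evalAt_of {Ω : Type*} [MeasurableSpace Ω] {P : Measure Ω} [IsFiniteMeasure P]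
    {Y : Ω → Sample n d} (h : ∀ i j, HasMoments (fun ω => Y ω i j) P) (f : Poly n d) :
    HasMoments (fun ω => evalAt f (Y ω)) P := by
  simp_rw [evalAt_eq_sum]
  exact HasMoments.sum _ fun s _ => (HasMoments.prod _ fun i _ =>
    HasMoments.prod _ fun j _ => (h i j).pow _).const_mul _

lemma hasMoments_pi_coord (h : ∀ j, HasMoments (fun y : Space d => y j) ν) (i : Fin n)
    (j : Fin d) : HasMoments (fun y : Sample n d => y i j) (Measure.pi fun _ => ν) :=
  (h j).comp (measurePreserving_eval (fun _ : Fin n => ν) i)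

end Sample

lemma hasMoments_inner_nullLaw (v : Sphere d) (i : Fin n) :
    HasMoments (fun y : Sample n d => inner ℝ (v : Space d) (y i)) (nullLaw n d) :=
  (hasMoments_inner_stdGaussian v).comp
    (measurePreserving_eval (fun _ : Fin n => stdGaussian (Space d)) i)

instance : IsProbabilityMeasure (nullLaw n d) := by unfold nullLaw; infer_instance

lemma hasMoments_evalAt_nullLaw (f : Poly n d) : HasMoments (evalAt f) (nullLaw n d) :=
  hasMoments_evalAt_of (Y := fun y => y) (hasMoments_pi_coord hasMoments_coord_stdGaussian) f

lemma hasMoments_lowDegreeRatio (A : Measure ℝ) (D : ℕ) (v : Sphere d) :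
    HasMoments (lowDegreeRatio (n := n) A D v) (nullLaw n d) :=
  HasMoments.sum _ fun _ _ => HasMoments.prod _ fun i _ =>
    ((hasMoments_inner_nullLaw v i).eval _).const_mul _

/-- `lowDegreeRatio` reproduces the expectation of every polynomial of degree at most `D`. -/
lemma integral_evalAt_hiddenDirection {A : Measure ℝ} [IsProbabilityMeasure A]
    (hA : HasMoments (fun x => x) A) (v : Sphere d) {D : ℕ} {f : Poly n d}
    (hf : f.totalDegree ≤ D) :
    ∫ y, evalAt f y ∂Measure.pi (fun _ : Fin n => hiddenDirection A v) =
      ∫ y, evalAt f y * lowDegreeRatio A D v y ∂nullLaw n d := by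
  have hmon : ∀ s : Fin n × Fin d →₀ ℕ, HasMoments
      (fun y : Sample n d => ∏ i, ∏ j, y i j ^ s (i, j)) (nullLaw n d) := fun s =>
    HasMoments.prod _ fun i _ => HasMoments.prod _ fun j _ =>
      (hasMoments_pi_coord hasMoments_coord_stdGaussian i j).pow _
  simp_rw [evalAt_eq_sum, Finset.sum_mul, mul_assoc]
  rw [integral_finsetSum _ fun s _ => (((HasMoments.prod _ fun i _ =>
    HasMoments.prod _ fun j _ => (hasMoments_pi_coord
      (hasMoments_coord_hiddenDirection hA v) i j).pow _)).const_mul _).integrable,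
    integral_finsetSum _ fun s _ =>
      (((hmon s).mul (hasMoments_lowDegreeRatio A D v)).const_mul _).integrable]
  refine Finset.sum_congr rfl fun s hs => ?_
  rw [integral_const_mul, integral_const_mul]
  congr 1
  have hdeg := sum_le_of_mem_support hf hs
  have hle : ∀ i, ∑ j, s (i, j) ≤ D := fun i =>
    (Finset.single_le_sum (f := fun i => ∑ j, s (i, j)) (fun _ _ => Nat.zero_le _)
      (Finset.mem_univ i)).trans hdeg
  let I : Fin n → ℕ → ℝ := fun i k => ∫ z, (∏ j, z j ^ s (i, j)) *
    (He k).eval (inner ℝ (v : Space d) z) ∂stdGaussian (Space d)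
  have hL : ∫ y : Sample n d, ∏ i, ∏ j, y i j ^ s (i, j)
      ∂Measure.pi (fun _ : Fin n => hiddenDirection A v) =
      ∑ K ∈ Fintype.piFinset fun _ : Fin n => Finset.range (D + 1),
        ∏ i, hermiteMoment A (K i) / (K i).factorial * I i (K i) := by
    rw [integral_fintype_prod_eq_prod (fun i (z : Space d) => ∏ j, z j ^ s (i, j))]
    exact (Finset.prod_congr rfl fun i _ =>
      integral_prod_pow_hiddenDirection hA v (hle i)).trans (Finset.prod_univ_sum _ _)
  have hR : ∫ y : Sample n d, (∏ i, ∏ j, y i j ^ s (i, j)) * lowDegreeRatio A D v y ∂nullLaw n d =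
      ∑ K ∈ degreeProfiles n D, ∏ i, hermiteMoment A (K i) / (K i).factorial * I i (K i) := by
    unfold lowDegreeRatio
    simp_rw [Finset.mul_sum]
    rw [integral_finsetSum _ fun K _ => ((hmon s).mul (HasMoments.prod _ fun i _ =>
      ((hasMoments_inner_nullLaw v i).eval _).const_mul _)).integrable]
    refine Finset.sum_congr rfl fun K _ => ?_
    simp_rw [← Finset.prod_mul_distrib]
    rw [nullLaw, integral_fintype_prod_eq_prod (fun i (z : Space d) => (∏ j, z j ^ s (i, j)) *
      (hermiteMoment A (K i) / (K i).factorial * (He (K i)).eval (inner ℝ (v : Space d) z)))]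
    refine Finset.prod_congr rfl fun i _ => ?_
    rw [← integral_const_mul]
    refine integral_congr_ae (.of_forall fun z => ?_)
    simp only
    ring
  rw [hL, hR, degreeProfiles]
  symm
  refine Finset.sum_subset (Finset.filter_subset _ _) fun K hK hK' => ?_
  have hgt : D < ∑ i, K i := by
    by_contra h
    exact hK' (Finset.mem_filter.2 ⟨hK, not_lt.1 h⟩)
  obtain ⟨i, -, hi⟩ : ∃ i ∈ Finset.univ, ∑ j, s (i, j) < K i :=
    Finset.exists_lt_of_sum_lt (hdeg.trans_lt hgt)
  refine Finset.prod_eq_zero (Finset.mem_univ i) ?_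
  rw [show I i (K i) = 0 from integral_prod_pow_mul_He_eq_zero v hi, mul_zero]

/-- The overlap of the low-degree ratios of two directions depends only on `⟨u, v⟩`. -/
lemma integral_lowDegreeRatio_mul (A : Measure ℝ) (D : ℕ) (u v : Sphere d) :
    ∫ y, lowDegreeRatio A D u y * lowDegreeRatio A D v y ∂nullLaw n d =
      ∑ K ∈ degreeProfiles n D, (∏ i, hermiteMoment A (K i) ^ 2 / (K i).factorial) *
        inner ℝ (u : Space d) (v : Space d) ^ ∑ i, K i := by
  have hm : ∀ (w : Sphere d) (K : Fin n → ℕ), HasMoments (fun y : Sample n d =>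
      ∏ i, hermiteMoment A (K i) / (K i).factorial *
        (He (K i)).eval (inner ℝ (w : Space d) (y i))) (nullLaw n d) := fun w K =>
    HasMoments.prod _ fun i _ => ((hasMoments_inner_nullLaw w i).eval _).const_mul _
  unfold lowDegreeRatio
  simp_rw [Finset.sum_mul_sum]
  rw [integral_finsetSum _ fun K _ =>
    (HasMoments.sum _ fun L _ => (hm u K).mul (hm v L)).integrable]
  refine Finset.sum_congr rfl fun K hK => ?_
  rw [integral_finsetSum _ fun L _ => ((hm u K).mul (hm v L)).integrable]
  have hKL : ∀ L : Fin n → ℕ, ∫ y : Sample n d, (∏ i, hermiteMoment A (K i) / (K i).factorial *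
        (He (K i)).eval (inner ℝ (u : Space d) (y i))) *
      (∏ i, hermiteMoment A (L i) / (L i).factorial *
        (He (L i)).eval (inner ℝ (v : Space d) (y i))) ∂nullLaw n d =
      ∏ i, (hermiteMoment A (K i) / (K i).factorial * (hermiteMoment A (L i) / (L i).factorial) *
        if K i = L i then ((L i).factorial : ℝ) * inner ℝ (u : Space d) (v : Space d) ^ L i
          else 0) := by
    intro L
    simp_rw [← Finset.prod_mul_distrib]
    rw [nullLaw, integral_fintype_prod_eq_prod (fun i (z : Space d) =>
      hermiteMoment A (K i) / (K i).factorial * (He (K i)).eval (inner ℝ (u : Space d) z) *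
      (hermiteMoment A (L i) / (L i).factorial * (He (L i)).eval (inner ℝ (v : Space d) z)))]
    refine Finset.prod_congr rfl fun i _ => ?_
    rw [← integral_He_inner_mul_He_inner, ← integral_const_mul]
    refine integral_congr_ae (.of_forall fun z => ?_)
    simp only
    ring
  simp_rw [hKL]
  rw [Finset.sum_eq_single_of_mem K hK]
  · simp only [if_true]
    rw [← Finset.prod_pow_eq_pow_sum, ← Finset.prod_mul_distrib]
    refine Finset.prod_congr rfl fun i _ => ?_
    have : ((K i).factorial : ℝ) ≠ 0 := by positivity
    field_simp
  · intro L _ hne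
    obtain ⟨i, hi⟩ := Function.ne_iff.1 hne
    exact Finset.prod_eq_zero (Finset.mem_univ i) (by rw [if_neg (Ne.symm hi), mul_zero])

/-! ### Hermite weights of the hidden mixture -/

section Mix
variable {Ω : Type} [MeasurableSpace Ω] {w : ℝ} {μ ν : Measure Ω}

lemma isProbabilityMeasure_mix (h0 : 0 ≤ w) (h1 : w ≤ 1) [IsProbabilityMeasure μ]
    [IsProbabilityMeasure ν] : IsProbabilityMeasure (mix w μ ν) := by
  refine ⟨?_⟩
  simp only [mix, Measure.add_apply, Measure.smul_apply, measure_univ, smul_eq_mul, mul_one]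
  rw [← ENNReal.ofReal_add (by linarith) h0]
  simp

lemma hasMoments_mix {F : Ω → ℝ} (hμ : HasMoments F μ) (hν : HasMoments F ν) :
    HasMoments F (mix w μ ν) := by
  intro k
  refine ⟨((hμ k).smul_measure ENNReal.ofReal_ne_top).1.add_measure
    ((hν k).smul_measure ENNReal.ofReal_ne_top).1, ?_⟩
  rcases eq_or_ne k 0 with rfl | hk
  · simp
  · have hk0 : (k : ℝ≥0∞) ≠ 0 := by exact_mod_cast hk
    have h1 := ((hμ k).smul_measure (c := ENNReal.ofReal (1 - w)) ENNReal.ofReal_ne_top).2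
    have h2 := ((hν k).smul_measure (c := ENNReal.ofReal w) ENNReal.ofReal_ne_top).2
    rw [eLpNorm_lt_top_iff_lintegral_rpow_enorm_lt_top hk0 (by simp)] at h1 h2 ⊢
    rw [mix, lintegral_add_measure]
    exact ENNReal.add_lt_top.2 ⟨h1, h2⟩

lemma integral_mix {F : Ω → ℝ} (h0 : 0 ≤ w) (h1 : w ≤ 1) (hμ : Integrable F μ)
    (hν : Integrable F ν) :
    ∫ x, F x ∂mix w μ ν = (1 - w) * ∫ x, F x ∂μ + w * ∫ x, F x ∂ν := by
  rw [mix, integral_add_measure (hμ.smul_measure ENNReal.ofReal_ne_top)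
    (hν.smul_measure ENNReal.ofReal_ne_top), integral_smul_measure, integral_smul_measure,
    ENNReal.toReal_ofReal (by linarith), ENNReal.toReal_ofReal h0]
  rfl

end Mix

instance (δ : ℝ) : IsProbabilityMeasure (symmetricPair δ) :=
  isProbabilityMeasure_mix (by norm_num) (by norm_num)

lemma hasMoments_symmetricPair (δ : ℝ) : HasMoments (fun x => x) (symmetricPair δ) :=
  hasMoments_mix (hasMoments_id_gaussianReal _ _) (hasMoments_id_gaussianReal _ _)

lemma isProbabilityMeasure_hiddenLaw {η : ℝ} (h0 : 0 ≤ η) (h1 : η ≤ 1) (α δ : ℝ) :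
    IsProbabilityMeasure (hiddenLaw η α δ) := isProbabilityMeasure_mix h0 h1

lemma hasMoments_hiddenLaw (η α δ : ℝ) : HasMoments (fun x => x) (hiddenLaw η α δ) :=
  hasMoments_mix (hasMoments_id_gaussianReal _ _) (hasMoments_symmetricPair δ)

lemma hermiteMoment_hiddenLaw {η : ℝ} (h0 : 0 ≤ η) (h1 : η ≤ 1) (α δ : ℝ) (k : ℕ) :
    hermiteMoment (hiddenLaw η α δ) k =
      (1 - η) * hermiteMoment (gaussianReal 0 (1 - α).toNNReal) k +
        η * ((δ ^ k + (-δ) ^ k) / 2) := by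
  rw [hermiteMoment, hiddenLaw, integral_mix h0 h1 (integrable_eval_gaussianReal _ _ _)
    ((hasMoments_symmetricPair δ).eval _).integrable, symmetricPair,
    integral_mix (by norm_num) (by norm_num) (integrable_eval_gaussianReal _ _ _)
    (integrable_eval_gaussianReal _ _ _)]
  have h1 := hermiteMoment_gaussianReal_var_one δ k
  have h2 := hermiteMoment_gaussianReal_var_one (-δ) k
  unfold hermiteMoment at *
  rw [h1, h2]
  ring

/-- The squared normalized Hermite coefficient `E_A[He_k]² / k!`. -/
def hermiteWeight (A : Measure ℝ) (k : ℕ) : ℝ := hermiteMoment A k ^ 2 / k.factorial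

lemma hermiteWeight_nonneg (A : Measure ℝ) (k : ℕ) : 0 ≤ hermiteWeight A k := by
  unfold hermiteWeight; positivity

section HiddenLaw
variable {η α δ : ℝ}

lemma hermiteWeight_hiddenLaw_odd (h0 : 0 ≤ η) (h1 : η ≤ 1) (hα : α < 1) {k : ℕ} (hk : Odd k) :
    hermiteWeight (hiddenLaw η α δ) k = 0 := by
  have hs : (1 - α).toNNReal ≠ 0 := by simpa using hα
  rw [hermiteWeight, hermiteMoment_hiddenLaw h0 h1, hermiteMoment_gaussianReal_odd hs hk,
    hk.neg_pow]
  simp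

/-- The condition on `δ` makes the variance of the hidden law equal to `1`. -/
lemma hermiteWeight_hiddenLaw_two (h0 : 0 ≤ η) (h1 : η ≤ 1) (hα : α < 1)
    (hδ : η * δ ^ 2 = α * (1 - η)) : hermiteWeight (hiddenLaw η α δ) 2 = 0 := by
  have hs : (1 - α).toNNReal ≠ 0 := by simpa using hα
  have h := hermiteMoment_gaussianReal_succ_succ 0 hs 0
  rw [hermiteMoment_zero, Real.coe_toNNReal _ (by linarith)] at h
  simp only [zero_add] at h
  have : hermiteMoment (hiddenLaw η α δ) 2 = 0 := by
    rw [hermiteMoment_hiddenLaw h0 h1, h]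
    simp
    linarith
  simp [hermiteWeight, this]

/-- The contribution `α^j` of the narrow component is dominated by the contribution
`η δ^{2j} ≤ η (α / η)^j` of the two shifted ones, because `η ≤ 1`. -/
lemma hermiteWeight_hiddenLaw_even_le (h0 : 0 < η) (h1 : η ≤ 1) (hα0 : 0 ≤ α) (hα : α < 1)
    (hδ : η * δ ^ 2 = α * (1 - η)) {j : ℕ} (hj : 1 ≤ j) :
    hermiteWeight (hiddenLaw η α δ) (2 * j) ≤ 4 * η ^ 2 * (α ^ 2 / η ^ 2) ^ j := by
  have hs : (1 - α).toNNReal ≠ 0 := by simpa using hα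
  have hg := sq_hermiteMoment_gaussianReal_even_le hs j
  rw [Real.coe_toNNReal _ (by linarith), show (1 - α - 1) ^ 2 = α ^ 2 by ring] at hg
  have hfac : (1 : ℝ) ≤ (2 * j).factorial := by
    exact_mod_cast Nat.succ_le_of_lt (Nat.factorial_pos _)
  rw [hermiteWeight, hermiteMoment_hiddenLaw h0.le h1, div_le_iff₀ (by linarith)]
  set h := hermiteMoment (gaussianReal 0 (1 - α).toNNReal) (2 * j)
  have hd2 : δ ^ 2 ≤ α / η := by
    rw [le_div_iff₀ h0]
    nlinarith
  have hd4 : (δ ^ (2 * j)) ^ 2 ≤ (α ^ 2 / η ^ 2) ^ j := by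
    rw [← div_pow, ← pow_mul, ← pow_mul, show 2 * j * 2 = 2 * (2 * j) by ring, pow_mul]
    exact pow_le_pow_left₀ (sq_nonneg _) hd2 _
  have hx : 0 ≤ (α ^ 2 / η ^ 2) ^ j := by positivity
  have hα2 : (α ^ 2) ^ j ≤ η ^ 2 * (α ^ 2 / η ^ 2) ^ j := by
    rw [div_pow, ← mul_div_assoc, le_div_iff₀ (by positivity), mul_comm]
    gcongr
    calc (η ^ 2) ^ j ≤ (η ^ 2) ^ 1 := pow_le_pow_of_le_one (by positivity) (by nlinarith) hj
      _ = η ^ 2 := pow_one _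
  have hneg : (-δ) ^ (2 * j) = δ ^ (2 * j) := (even_two_mul j).neg_pow δ
  rw [hneg, show (δ ^ (2 * j) + δ ^ (2 * j)) / 2 = δ ^ (2 * j) by ring]
  calc ((1 - η) * h + η * δ ^ (2 * j)) ^ 2
      ≤ 2 * ((1 - η) ^ 2 * h ^ 2 + η ^ 2 * (δ ^ (2 * j)) ^ 2) := by
        nlinarith [sq_nonneg ((1 - η) * h - η * δ ^ (2 * j))]
    _ ≤ 2 * (1 * (η ^ 2 * (α ^ 2 / η ^ 2) ^ j * (2 * j).factorial) +
          η ^ 2 * (α ^ 2 / η ^ 2) ^ j * (2 * j).factorial) := by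
        have e1 : (1 - η) ^ 2 ≤ 1 := by nlinarith
        have e2 : h ^ 2 ≤ η ^ 2 * (α ^ 2 / η ^ 2) ^ j * (2 * j).factorial :=
          hg.trans (by gcongr)
        have e3 : η ^ 2 * (δ ^ (2 * j)) ^ 2 ≤ η ^ 2 * (α ^ 2 / η ^ 2) ^ j * (2 * j).factorial :=
          (mul_le_mul_of_nonneg_left hd4 (by positivity)).trans
            (le_mul_of_one_le_right (by positivity) hfac)
        have e4 := mul_le_mul e1 e2 (sq_nonneg h) zero_le_one
        linarith
    _ = _ := by ring

end HiddenLaw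

lemma sum_range_two_mul_of_odd_eq_zero {f : ℕ → ℝ} (hodd : ∀ k, Odd k → f k = 0) (N : ℕ) :
    ∑ k ∈ Finset.range (2 * N), f k = ∑ j ∈ Finset.range N, f (2 * j) := by
  induction N with
  | zero => simp
  | succ N ih =>
    rw [show 2 * (N + 1) = 2 * N + 1 + 1 by ring, Finset.sum_range_succ, Finset.sum_range_succ, ih,
      Finset.sum_range_succ, hodd _ (odd_two_mul_add_one N), add_zero]

/-- The generating series of the weights starts `1 + O(η² (α r / η)⁴)`: the first three moments of
the hidden law agree with those of `N(0, 1)`. -/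
lemma sum_hermiteWeight_le {η α δ : ℝ} (h0 : 0 < η) (h1 : η ≤ 1) (hα0 : 0 ≤ α) (hα : α < 1)
    (hδ : η * δ ^ 2 = α * (1 - η)) {r : ℝ} (hr : 0 ≤ r) (D : ℕ) :
    ∑ k ∈ Finset.range (D + 1), hermiteWeight (hiddenLaw η α δ) k * r ^ k ≤
      1 + 4 * η ^ 2 * (α ^ 2 / η ^ 2 * r ^ 2) ^ 2 *
        ∑ i ∈ Finset.range D, (α ^ 2 / η ^ 2 * r ^ 2) ^ i := by
  have := isProbabilityMeasure_hiddenLaw h0.le h1 α δ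
  set f : ℕ → ℝ := fun k => hermiteWeight (hiddenLaw η α δ) k * r ^ k with hf
  have hf0 : ∀ k, 0 ≤ f k := fun k => mul_nonneg (hermiteWeight_nonneg _ _) (by positivity)
  calc ∑ k ∈ Finset.range (D + 1), f k ≤ ∑ k ∈ Finset.range (2 * (D + 2)), f k :=
        Finset.sum_le_sum_of_subset_of_nonneg (Finset.range_subset_range.2 (by omega))
          fun k _ _ => hf0 k
    _ = ∑ j ∈ Finset.range (D + 2), f (2 * j) := sum_range_two_mul_of_odd_eq_zero
        (fun k hk => by simp [hf, hermiteWeight_hiddenLaw_odd h0.le h1 hα hk]) _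
    _ = 1 + ∑ i ∈ Finset.range D, f (2 * (i + 2)) := by
        rw [Finset.sum_range_succ', Finset.sum_range_succ']
        have e0 : f (2 * 0) = 1 := by simp [hf, hermiteWeight]
        have e1 : f (2 * (0 + 1)) = 0 := by
          simp [hf, hermiteWeight_hiddenLaw_two h0.le h1 hα hδ]
        rw [e0, e1]
        ring
    _ ≤ _ := by
        rw [Finset.mul_sum]
        gcongr with i _
        calc f (2 * (i + 2)) ≤ 4 * η ^ 2 * (α ^ 2 / η ^ 2) ^ (i + 2) * r ^ (2 * (i + 2)) := by
              exact mul_le_mul_of_nonneg_right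
                (hermiteWeight_hiddenLaw_even_le h0 h1 hα0 hα hδ (by omega)) (by positivity)
          _ = _ := by rw [pow_mul, mul_assoc, ← mul_pow]; ring

/-! ### The sum over multi-degrees -/

lemma abs_inner_sphere_le (u : Sphere d) (x : Space d) : |inner ℝ (u : Space d) x| ≤ ‖x‖ := by
  simpa [norm_eq_of_mem_sphere] using abs_real_inner_le_norm (u : Space d) x

lemma hasMoments_inner_sphere_prod [IsProbabilityMeasure (uniformSphere d)] :
    HasMoments (fun p : Sphere d × Sphere d => inner ℝ (p.1 : Space d) (p.2 : Space d))
      ((uniformSphere d).prod (uniformSphere d)) :=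
  (hasMoments_const 1).mono (Continuous.aestronglyMeasurable (by fun_prop)) fun p => by
    simpa [norm_eq_of_mem_sphere] using abs_inner_sphere_le p.1 (p.2 : Space d)

lemma integral_inner_pow_sphere_prod_le (hd : 0 < d) {D m : ℕ} (hm : 2 * m ≤ D) :
    ∫ p : Sphere d × Sphere d, inner ℝ (p.1 : Space d) (p.2 : Space d) ^ (2 * m)
      ∂(uniformSphere d).prod (uniformSphere d) ≤ (D / d : ℝ) ^ m := by
  have := isProbabilityMeasure_uniformSphere hd
  have hi := (hasMoments_inner_sphere_prod (d := d)).pow (2 * m)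
  rw [integral_prod _ hi.integrable]
  calc _ ≤ ∫ _ : Sphere d, (D / d : ℝ) ^ m ∂uniformSphere d :=
        integral_mono hi.integrable.integral_prod_left (integrable_const _) fun u =>
          integral_inner_pow_uniformSphere_le hd u (by exact_mod_cast hm)
    _ = _ := by simp

/-- The truncation `∑ K ≤ D` is what allows the sphere moments to be bounded by powers of `D / d`;
after that it can be dropped, and the sum over all multi-degrees factors over the samples. -/
lemma sum_degreeProfiles_le (hd : 0 < d) {w : ℕ → ℝ} (hw : ∀ k, 0 ≤ w k)
    (hodd : ∀ k, Odd k → w k = 0) (D : ℕ) :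
    ∑ K ∈ degreeProfiles n D, (∏ i, w (K i)) *
      ∫ p : Sphere d × Sphere d, inner ℝ (p.1 : Space d) (p.2 : Space d) ^ (∑ i, K i)
        ∂(uniformSphere d).prod (uniformSphere d) ≤
    (∑ k ∈ Finset.range (D + 1), w k * √(D / d) ^ k) ^ n := by
  have hr : (√(D / d : ℝ)) ^ 2 = D / d := Real.sq_sqrt (by positivity)
  calc _ ≤ ∑ K ∈ degreeProfiles n D, ∏ i, (w (K i) * √(D / d) ^ (K i)) := by
        refine Finset.sum_le_sum fun K hK => ?_
        by_cases h : ∃ i, Odd (K i)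
        · obtain ⟨i, hi⟩ := h
          rw [Finset.prod_eq_zero (Finset.mem_univ i) (hodd _ hi), zero_mul,
            Finset.prod_eq_zero (Finset.mem_univ i) (by rw [hodd _ hi, zero_mul])]
        · simp only [not_exists, Nat.not_odd_iff_even] at h
          rw [Finset.prod_mul_distrib, Finset.prod_pow_eq_pow_sum]
          refine mul_le_mul_of_nonneg_left ?_ (Finset.prod_nonneg fun i _ => hw _)
          obtain ⟨m, hm⟩ := (Finset.even_sum _ fun i _ => h i : Even (∑ i, K i)).two_dvd
          have hD : ∑ i, K i ≤ D := (Finset.mem_filter.1 hK).2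
          rw [hm, pow_mul (√_), hr]
          exact integral_inner_pow_sphere_prod_le hd (hm ▸ hD)
    _ ≤ ∑ K ∈ Fintype.piFinset fun _ : Fin n => Finset.range (D + 1),
          ∏ i, (w (K i) * √(D / d) ^ (K i)) :=
        Finset.sum_le_sum_of_subset_of_nonneg (Finset.filter_subset _ _) fun K _ _ =>
          Finset.prod_nonneg fun i _ => mul_nonneg (hw _) (by positivity)
    _ = _ := by
        rw [← Finset.prod_univ_sum (fun _ : Fin n => Finset.range (D + 1))
          (fun _ k => w k * √(D / d) ^ k)]
        simp

/-- With `x = α² D / (d η²)`, the upper bound on `n` gives `4 n η² x² ≤ 1`. Combined with `d ≤ n`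
it gives `x ≤ 1 / (c D)`, so the geometric sum of length `D` is at most `exp (1 / c)` even though
`x` may exceed `1`. -/
lemma geometric_exponent_le {c d η α n : ℝ} {D : ℕ} (hc : 0 < c) (hd : 0 < d) (hη : 0 < η)
    (hα : 0 < α) (hcη : c / √d ≤ η) (hdn : d ≤ n)
    (hn : n ≤ d ^ 2 * η ^ 2 / (4 * (D + 1 : ℝ) ^ 4 * α ^ 4)) :
    n * (4 * η ^ 2 * (α ^ 2 / η ^ 2 * (D / d)) ^ 2 *
      ∑ i ∈ Finset.range D, (α ^ 2 / η ^ 2 * (D / d)) ^ i) ≤ Real.exp (1 / c) := by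
  set x : ℝ := α ^ 2 / η ^ 2 * (D / d) with hx
  have hx0 : 0 ≤ x := by positivity
  have hn' : n * (4 * (D + 1 : ℝ) ^ 4 * α ^ 4) ≤ d ^ 2 * η ^ 2 :=
    (le_div_iff₀ (by positivity)).1 hn
  have hDD : (D : ℝ) ^ 2 ≤ (D + 1 : ℝ) ^ 4 := by
    have : (0 : ℝ) ≤ D := D.cast_nonneg
    nlinarith [sq_nonneg ((D : ℝ) + 1), sq_nonneg ((D : ℝ))]
  have h1 : n * (4 * η ^ 2 * x ^ 2) ≤ 1 := by
    have e : n * (4 * η ^ 2 * x ^ 2) = n * (4 * D ^ 2 * α ^ 4) / (d ^ 2 * η ^ 2) := by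
      rw [hx]; field_simp
    rw [e, div_le_one (by positivity)]
    refine le_trans ?_ hn'
    have : 0 ≤ n := hd.le.trans hdn
    gcongr
  have hcd : c ^ 2 ≤ d * η ^ 2 := by
    have h := (div_le_iff₀ (Real.sqrt_pos.2 hd)).1 hcη
    calc c ^ 2 ≤ (η * √d) ^ 2 := by gcongr
      _ = d * η ^ 2 := by rw [mul_pow, Real.sq_sqrt hd.le]; ring
  have hpα : (4 * (D + 1 : ℝ) ^ 4 * α ^ 4) ≤ d * η ^ 2 := by
    have : d * (4 * (D + 1 : ℝ) ^ 4 * α ^ 4) ≤ d * (d * η ^ 2) :=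
      (mul_le_mul_of_nonneg_right hdn (by positivity)).trans (hn'.trans_eq (by ring))
    exact le_of_mul_le_mul_left this hd
  have hxD : x * D ≤ 1 / c := by
    refine (sq_le_sq₀ (by positivity) (by positivity)).1 ?_
    have e : (x * D) ^ 2 = (D : ℝ) ^ 4 * α ^ 4 / (d * η ^ 2) ^ 2 := by
      rw [hx]; field_simp
    have hD4 : (D : ℝ) ^ 4 * α ^ 4 ≤ d * η ^ 2 := by
      refine le_trans ?_ hpα
      gcongr
      have : (D : ℝ) ^ 4 ≤ (D + 1 : ℝ) ^ 4 := by gcongr; linarith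
      nlinarith [pow_nonneg (D.cast_nonneg : (0 : ℝ) ≤ D) 4]
    rw [e, div_pow, one_pow, div_le_div_iff₀ (by positivity) (by positivity), one_mul]
    calc (D : ℝ) ^ 4 * α ^ 4 * c ^ 2 ≤ (d * η ^ 2) * (d * η ^ 2) := by gcongr
      _ = _ := by ring
  have hsum : ∑ i ∈ Finset.range D, x ^ i ≤ Real.exp (1 / c) := by
    refine le_trans (Finset.sum_le_sum fun i hi => ?_)
      (Real.sum_le_exp_of_nonneg (x := 1 / c) (by positivity) D)
    rw [le_div_iff₀ (by positivity)]
    -- The number of terms pays for a large ratio: `x ^ i ≤ (1 / c) ^ i / D ^ i ≤ (1 / c) ^ i / i!`.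
    have hf : (i.factorial : ℝ) ≤ (D : ℝ) ^ i := by
      have h1 : i.factorial ≤ i ^ i := Nat.factorial_le_pow i
      have h2 : i ^ i ≤ D ^ i := Nat.pow_le_pow_left (Finset.mem_range.1 hi).le i
      exact_mod_cast h1.trans h2
    calc x ^ i * i.factorial ≤ x ^ i * (D : ℝ) ^ i := by gcongr
      _ = (x * D) ^ i := (mul_pow _ _ _).symm
      _ ≤ (1 / c) ^ i := by gcongr
  calc _ = (n * (4 * η ^ 2 * x ^ 2)) * ∑ i ∈ Finset.range D, x ^ i := by ring
    _ ≤ 1 * Real.exp (1 / c) := by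
        refine mul_le_mul h1 hsum (Finset.sum_nonneg fun i _ => by positivity) zero_le_one
    _ = _ := one_mul _

/-! ### The alternative law and its advantage -/

lemma continuous_place_uncurry :
    Continuous (fun p : Sphere d × (ℝ × Space d) => place p.1 p.2) := by
  unfold place; fun_prop

/-- The family `v ↦ P_{A,v}` as a Markov kernel: the image of `A × N(0, I_d)` under a map that is
jointly continuous in the direction and the noise. -/
def hiddenDirectionKernel (d : ℕ) (A : Measure ℝ) [IsProbabilityMeasure A] :
    Kernel (Sphere d) (Space d) :=
  (Kernel.id ×ₖ Kernel.const (Sphere d) (A.prod (stdGaussian (Space d)))).map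
    fun p => place p.1 p.2

lemma hiddenDirectionKernel_apply (A : Measure ℝ) [IsProbabilityMeasure A] (v : Sphere d) :
    hiddenDirectionKernel d A v = hiddenDirection A v := by
  rw [hiddenDirectionKernel, Kernel.map_apply _ continuous_place_uncurry.measurable,
    Kernel.prod_apply, Kernel.id_apply, Kernel.const_apply, Measure.dirac_prod,
    Measure.map_map continuous_place_uncurry.measurable measurable_prodMk_left]
  rfl

instance (A : Measure ℝ) [IsProbabilityMeasure A] :
    IsMarkovKernel (hiddenDirectionKernel d A) :=
  ⟨fun v => by rw [hiddenDirectionKernel_apply]; infer_instance⟩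

/-- `place` applied with a common direction to each of `n` samples. -/
def placeSample (p : Sphere d × (Fin n → ℝ × Space d)) : Sample n d := fun i => place p.1 (p.2 i)

lemma continuous_placeSample : Continuous (placeSample (d := d) (n := n)) := by
  unfold placeSample place; fun_prop

lemma measurable_placeSample_right (v : Sphere d) :
    Measurable fun x : Fin n → ℝ × Space d => placeSample (v, x) :=
  continuous_placeSample.measurable.comp measurable_prodMk_left

section AltLaw
variable {A : Measure ℝ} [IsProbabilityMeasure A]

lemma pi_hiddenDirection (v : Sphere d) :
    Measure.pi (fun _ : Fin n => hiddenDirection A v) =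
      (Measure.pi fun _ : Fin n => A.prod (stdGaussian (Space d))).map
        fun x => placeSample (v, x) := by
  have := Measure.pi_map_pi (μ := fun _ : Fin n => A.prod (stdGaussian (Space d)))
    (f := fun _ => place v) fun _ => (measurable_place v).aemeasurable
  exact this.symm

/-- The alternative law is the image of a product measure, which reduces its moments and
iterated integrals to Fubini's theorem. -/
lemma altLaw_hiddenDirection [IsProbabilityMeasure (uniformSphere d)] :
    altLaw n (fun v : Sphere d => hiddenDirection A v) =
      ((uniformSphere d).prod (Measure.pi fun _ : Fin n => A.prod (stdGaussian (Space d)))).map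
        placeSample := by
  have hm := (continuous_placeSample (d := d) (n := n)).measurable
  have hmeas : Measurable fun v : Sphere d => Measure.pi fun _ : Fin n => hiddenDirection A v := by
    have : (fun v : Sphere d => Measure.pi fun _ : Fin n => hiddenDirection A v) = fun v =>
        ((Measure.pi fun _ : Fin n => A.prod (stdGaussian (Space d))).map (Prod.mk v)).map
          placeSample := by
      funext v
      rw [pi_hiddenDirection, Measure.map_map hm measurable_prodMk_left]
      rfl
    rw [this]
    exact (Measure.measurable_map _ hm).comp Measurable.map_prodMk_left
  ext s hs
  rw [altLaw, Measure.bind_apply hs hmeas.aemeasurable, Measure.map_apply hm hs,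
    Measure.prod_apply (hm hs)]
  refine lintegral_congr fun v => ?_
  rw [pi_hiddenDirection, Measure.map_apply (measurable_placeSample_right v) hs]
  rfl

lemma hasMoments_placeSample [IsProbabilityMeasure (uniformSphere d)]
    (hA : HasMoments (fun x => x) A) (i : Fin n) (j : Fin d) :
    HasMoments (fun p => placeSample p i j)
      ((uniformSphere d).prod (Measure.pi fun _ : Fin n => A.prod (stdGaussian (Space d)))) := by
  have hi : MeasurePreserving (fun p : Sphere d × (Fin n → ℝ × Space d) => p.2 i)
      ((uniformSphere d).prod (Measure.pi fun _ : Fin n => A.prod (stdGaussian (Space d))))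
      (A.prod (stdGaussian (Space d))) :=
    (measurePreserving_eval (fun _ : Fin n => A.prod (stdGaussian (Space d))) i).comp
      measurePreserving_snd
  have h1 : HasMoments (fun x => |x|) A := fun k => (hA k).norm
  have h := ((h1.comp measurePreserving_fst).comp hi).add
    (((hasMoments_norm_stdGaussian.comp measurePreserving_snd).comp hi).const_mul 2)
  refine h.mono (Continuous.aestronglyMeasurable (by unfold placeSample place; fun_prop))
    fun p => ?_
  rw [abs_of_nonneg (a := _ + _) (by positivity)]
  calc |placeSample p i j| ≤ ‖placeSample p i‖ := by
        simpa using PiLp.norm_apply_le (placeSample p i) j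
    _ ≤ ‖(p.2 i).1 • (p.1 : Space d)‖ + (‖(p.2 i).2‖ +
          ‖inner ℝ (p.1 : Space d) (p.2 i).2 • (p.1 : Space d)‖) :=
        (norm_add_le _ _).trans (by gcongr; exact norm_sub_le _ _)
    _ ≤ |(p.2 i).1| + 2 * ‖(p.2 i).2‖ := by
        have := abs_inner_sphere_le p.1 (p.2 i).2
        rw [norm_smul, norm_smul, norm_eq_of_mem_sphere]
        simp only [Real.norm_eq_abs, mul_one]
        linarith

lemma isProbabilityMeasure_altLaw_hiddenDirection [IsProbabilityMeasure (uniformSphere d)] :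
    IsProbabilityMeasure (altLaw n fun v : Sphere d => hiddenDirection A v) := by
  rw [altLaw_hiddenDirection]
  exact Measure.isProbabilityMeasure_map continuous_placeSample.measurable.aemeasurable

lemma continuous_evalAt (f : Poly n d) : Continuous (evalAt f) := by
  have : evalAt f = fun y => ∑ s ∈ f.support, f.coeff s * ∏ i, ∏ j, y i j ^ s (i, j) :=
    funext (evalAt_eq_sum f)
  rw [this]
  fun_prop

lemma hasMoments_evalAt_altLaw [IsProbabilityMeasure (uniformSphere d)]
    (hA : HasMoments (fun x => x) A) (f : Poly n d) :
    HasMoments (evalAt f) (altLaw n fun v : Sphere d => hiddenDirection A v) := by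
  rw [altLaw_hiddenDirection, hasMoments_map continuous_placeSample.measurable
    (continuous_evalAt f).measurable]
  exact hasMoments_evalAt_of (hasMoments_placeSample hA) f

lemma integral_evalAt_altLaw [IsProbabilityMeasure (uniformSphere d)]
    (hA : HasMoments (fun x => x) A) {D : ℕ} {f : Poly n d} (hf : f.totalDegree ≤ D) :
    ∫ y, evalAt f y ∂altLaw n (fun v : Sphere d => hiddenDirection A v) =
      ∫ v, ∫ y, evalAt f y * lowDegreeRatio A D v y ∂nullLaw n d ∂uniformSphere d := by
  rw [altLaw_hiddenDirection, integral_map continuous_placeSample.measurable.aemeasurable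
    (continuous_evalAt f).aestronglyMeasurable,
    integral_prod _ (hasMoments_evalAt_of (hasMoments_placeSample hA) f).integrable]
  refine integral_congr_ae (.of_forall fun v => ?_)
  simp only
  rw [← integral_evalAt_hiddenDirection hA v hf, pi_hiddenDirection,
    integral_map (measurable_placeSample_right v).aemeasurable
    (continuous_evalAt f).aestronglyMeasurable]

end AltLaw

lemma hasMoments_lowDegreeRatio_comp {Ω : Type*} [TopologicalSpace Ω] [MeasurableSpace Ω]
    [OpensMeasurableSpace Ω] [SecondCountableTopology Ω] {μ : Measure Ω} [IsProbabilityMeasure μ]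
    {φ : Ω → Sphere d} (hφ : Continuous φ) (A : Measure ℝ) (D : ℕ) :
    HasMoments (fun p : Ω × Sample n d => lowDegreeRatio A D (φ p.1) p.2)
      (μ.prod (nullLaw n d)) := by
  refine HasMoments.sum _ fun K _ => HasMoments.prod _ fun i _ => HasMoments.const_mul ?_ _
  refine HasMoments.eval ?_ _
  have h : HasMoments (fun p : Ω × Sample n d => ‖p.2 i‖) (μ.prod (nullLaw n d)) :=
    (hasMoments_norm_stdGaussian.comp
      (measurePreserving_eval (fun _ : Fin n => stdGaussian (Space d)) i)).comp
      measurePreserving_snd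
  refine h.mono (Continuous.aestronglyMeasurable (by fun_prop)) fun p => ?_
  rw [abs_norm]
  exact abs_inner_sphere_le _ _

/-- The second moment, under the null law, of the low-degree ratio averaged over the direction. -/
lemma integral_sq_average_lowDegreeRatio [IsProbabilityMeasure (uniformSphere d)]
    (A : Measure ℝ) (D : ℕ) :
    Integrable (fun y : Sample n d => (∫ v, lowDegreeRatio A D v y ∂uniformSphere d) ^ 2)
      (nullLaw n d) ∧
    ∫ y, (∫ v, lowDegreeRatio A D v y ∂uniformSphere d) ^ 2 ∂nullLaw n d =
      ∑ K ∈ degreeProfiles n D, (∏ i, hermiteWeight A (K i)) *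
        ∫ p : Sphere d × Sphere d, inner ℝ (p.1 : Space d) (p.2 : Space d) ^ (∑ i, K i)
          ∂(uniformSphere d).prod (uniformSphere d) := by
  have hF := ((hasMoments_lowDegreeRatio_comp (n := n)
    (μ := (uniformSphere d).prod (uniformSphere d)) continuous_fst A D).mul
    (hasMoments_lowDegreeRatio_comp continuous_snd A D)).integrable
  have e : ∀ y : Sample n d, (∫ v, lowDegreeRatio A D v y ∂uniformSphere d) ^ 2 =
      ∫ p : Sphere d × Sphere d, lowDegreeRatio A D p.1 y * lowDegreeRatio A D p.2 y
        ∂(uniformSphere d).prod (uniformSphere d) := by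
    intro y
    rw [sq, ← integral_prod_mul]
  simp_rw [e]
  refine ⟨hF.integral_prod_right, ?_⟩
  rw [← integral_prod_symm _ hF, integral_prod _ hF]
  simp only [integral_lowDegreeRatio_mul]
  rw [integral_finsetSum _ fun K _ => (hasMoments_inner_sphere_prod.pow _).integrable.const_mul _]
  simp_rw [integral_const_mul]
  rfl

/-- The squared advantage is at most the second moment of the averaged low-degree ratio. -/
lemma degreeAdvantage_altLaw_le [IsProbabilityMeasure (uniformSphere d)] {A : Measure ℝ}
    [IsProbabilityMeasure A] (hA : HasMoments (fun x => x) A) {D : ℕ} {B : ℝ} (hB : 0 < B)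
    (h : ∑ K ∈ degreeProfiles n D, (∏ i, hermiteWeight A (K i)) *
        ∫ p : Sphere d × Sphere d, inner ℝ (p.1 : Space d) (p.2 : Space d) ^ (∑ i, K i)
          ∂(uniformSphere d).prod (uniformSphere d) ≤ B ^ 2) :
    degreeAdvantage D (nullLaw n d) (altLaw n fun v : Sphere d => hiddenDirection A v) ≤
      (B : EReal) := by
  refine iSup_le fun f => ?_
  obtain ⟨f, hf, hpos⟩ := f
  simp only
  rw [EReal.coe_le_coe_iff, div_le_iff₀ (Real.sqrt_pos.2 hpos), integral_evalAt_altLaw hA hf]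
  set s := √(∫ y, evalAt f y ^ 2 ∂nullLaw n d) with hs
  have hs0 : 0 < s := Real.sqrt_pos.2 hpos
  have hs2 : ∫ y, evalAt f y ^ 2 ∂nullLaw n d = s ^ 2 := (Real.sq_sqrt hpos.le).symm
  obtain ⟨hi, hG⟩ := integral_sq_average_lowDegreeRatio (n := n) (d := d) A D
  set G : Sample n d → ℝ := fun y => ∫ v, lowDegreeRatio A D v y ∂uniformSphere d
  have hfR : Integrable (fun p : Sphere d × Sample n d => evalAt f p.2 * lowDegreeRatio A D p.1 p.2)
      ((uniformSphere d).prod (nullLaw n d)) :=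
    (((hasMoments_evalAt_nullLaw f).comp measurePreserving_snd).mul
      (hasMoments_lowDegreeRatio_comp continuous_id A D)).integrable
  have hfG : Integrable (fun y => evalAt f y * G y) (nullLaw n d) := by
    have := hfR.integral_prod_right
    simpa only [integral_const_mul] using this
  rw [integral_integral_swap (f := fun v y => evalAt f y * lowDegreeRatio A D v y) hfR]
  simp_rw [integral_const_mul]
  -- Cauchy–Schwarz in the form `f G ≤ (B / 2s) f² + (s / 2B) G²`, with `s² = E[f²]`.
  calc ∫ y, evalAt f y * G y ∂nullLaw n d
      ≤ ∫ y, (B / (2 * s) * evalAt f y ^ 2 + s / (2 * B) * G y ^ 2) ∂nullLaw n d := by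
        refine integral_mono hfG ((((hasMoments_evalAt_nullLaw f).pow 2).integrable.const_mul _).add
          (hi.const_mul _)) fun y => ?_
        have : B / (2 * s) * evalAt f y ^ 2 + s / (2 * B) * G y ^ 2 - evalAt f y * G y =
            (B * evalAt f y - s * G y) ^ 2 / (2 * s * B) := by
          field_simp; ring
        have h0 : 0 ≤ (B * evalAt f y - s * G y) ^ 2 / (2 * s * B) := by positivity
        simp only
        linarith
    _ = B / (2 * s) * s ^ 2 + s / (2 * B) * ∫ y, G y ^ 2 ∂nullLaw n d := by
        rw [integral_add (((hasMoments_evalAt_nullLaw f).pow 2).integrable.const_mul _)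
          (hi.const_mul _), integral_const_mul, integral_const_mul, hs2]
    _ ≤ B / (2 * s) * s ^ 2 + s / (2 * B) * B ^ 2 := by
        rw [hG]; gcongr
    _ = B * s := by field_simp; ring

end LowDegree

end

theorem proposition8p6 :
    ∃ p : Polynomial ℝ, (∀ D : ℕ, 0 < p.eval (D : ℝ)) ∧
      ∀ c : ℝ, 0 < c → ∃ B : ℝ,
        ∀ (d : ℕ) (η α : ℝ), 0 < d → 0 < η → η < 1 / 2 → 0 < α → α < 1 →
          c / Real.sqrt d ≤ η →
          ∃ (Q : Kernel (LowDegree.Sphere d) (LowDegree.Space d)) (δ : ℝ),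
            IsMarkovKernel Q ∧ 0 < δ ∧
            (∀ v, Q v = LowDegree.hiddenDirection (LowDegree.symmetricPair δ) v) ∧
            (∀ v, LowDegree.mix η (LowDegree.inlier α v) (Q v) =
              LowDegree.hiddenDirection (LowDegree.hiddenLaw η α δ) v) ∧
            (∀ n : ℕ,
              IsProbabilityMeasure (LowDegree.altLaw n fun v : LowDegree.Sphere d =>
                LowDegree.mix η (LowDegree.inlier α v) (Q v)) ∧
              ∀ f : LowDegree.Poly n d,
                Integrable (LowDegree.evalAt f) (LowDegree.altLaw n fun v =>
                  LowDegree.mix η (LowDegree.inlier α v) (Q v))) ∧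
            ∀ n D : ℕ, (d : ℝ) ≤ n →
              (n : ℝ) ≤ (d : ℝ) ^ 2 * η ^ 2 / (p.eval (D : ℝ) * α ^ 4) →
              LowDegree.degreeAdvantage D (LowDegree.nullLaw n d)
                (LowDegree.altLaw n fun v =>
                  LowDegree.mix η (LowDegree.inlier α v) (Q v)) ≤ (B : EReal) := by
  have hp : ∀ D : ℕ, (Polynomial.C 4 * (Polynomial.X + 1) ^ 4 : Polynomial ℝ).eval (D : ℝ) =
      4 * (D + 1 : ℝ) ^ 4 := fun D => by simp
  refine ⟨Polynomial.C 4 * (Polynomial.X + 1) ^ 4, fun D => by rw [hp]; positivity, fun c hc =>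
    ⟨Real.exp (Real.exp (1 / c)), fun d η α hd hη hη2 hα0 hα1 hcη => ?_⟩⟩
  have hsphere := LowDegree.isProbabilityMeasure_uniformSphere hd
  have hη1 : η ≤ 1 := by linarith
  have hδ0 : 0 < α * (1 - η) / η := div_pos (mul_pos hα0 (by linarith)) hη
  -- The choice for which the mixture has unit variance.
  set δ := √(α * (1 - η) / η) with hδdef
  have hδ : η * δ ^ 2 = α * (1 - η) := by
    rw [hδdef, Real.sq_sqrt hδ0.le]; field_simp
  have hprob := LowDegree.isProbabilityMeasure_hiddenLaw hη.le hη1 α δ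
  have hmom := LowDegree.hasMoments_hiddenLaw η α δ
  have hmix : ∀ v : LowDegree.Sphere d, LowDegree.mix η (LowDegree.inlier α v)
      (LowDegree.hiddenDirectionKernel d (LowDegree.symmetricPair δ) v) =
      LowDegree.hiddenDirection (LowDegree.hiddenLaw η α δ) v := fun v => by
    rw [LowDegree.hiddenDirectionKernel_apply, LowDegree.hiddenLaw, LowDegree.hiddenDirection_mix,
      LowDegree.hiddenDirection_gaussianReal hα1.le]
  refine ⟨LowDegree.hiddenDirectionKernel d (LowDegree.symmetricPair δ), δ, inferInstance,
    Real.sqrt_pos.2 hδ0, LowDegree.hiddenDirectionKernel_apply _, hmix, fun n => ?_,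
    fun n D hdn hn => ?_⟩
  · simp_rw [hmix]
    exact ⟨LowDegree.isProbabilityMeasure_altLaw_hiddenDirection,
      fun f => (LowDegree.hasMoments_evalAt_altLaw hmom f).integrable⟩
  · simp_rw [hmix]
    rw [hp] at hn
    refine LowDegree.degreeAdvantage_altLaw_le hmom (Real.exp_pos _) ?_
    have hd' : (0 : ℝ) < d := by exact_mod_cast hd
    refine (LowDegree.sum_degreeProfiles_le hd (LowDegree.hermiteWeight_nonneg _)
      (fun k hk => LowDegree.hermiteWeight_hiddenLaw_odd hη.le hη1 hα1 hk) D).trans ?_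
    have hsum := LowDegree.sum_hermiteWeight_le hη hη1 hα0.le hα1 hδ
      (Real.sqrt_nonneg (D / d : ℝ)) D
    rw [Real.sq_sqrt (by positivity)] at hsum
    have hexp := LowDegree.geometric_exponent_le hc hd' hη hα0 hcη hdn hn
    set T := 4 * η ^ 2 * (α ^ 2 / η ^ 2 * (D / d : ℝ)) ^ 2 *
        ∑ i ∈ Finset.range D, (α ^ 2 / η ^ 2 * (D / d : ℝ)) ^ i
    calc _ ≤ (Real.exp T) ^ n := by
          refine pow_le_pow_left₀ (Finset.sum_nonneg fun k _ =>
            mul_nonneg (LowDegree.hermiteWeight_nonneg _ _) (by positivity)) ?_ n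
          linarith [Real.add_one_le_exp T]
      _ = Real.exp (n * T) := (Real.exp_nat_mul T n).symm
      _ ≤ Real.exp (Real.exp (1 / c)) := Real.exp_le_exp.2 hexp
      _ ≤ Real.exp (Real.exp (1 / c)) ^ 2 :=
          le_self_pow₀ (Real.one_le_exp (Real.exp_pos _).le) two_ne_zero
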